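/- **Theorem 1.2 (Reduction to a one-dimensional nonlocal PDE).** Let $n\ge 2$, $s\in(\tfrac12,1)$, $\tilde s\in(s,1)$, $t\ge 0$ with $2s-\tilde s>\max\{t,\tfrac12\}$, let $p\in(2,\infty)$ and $\tfrac1p+\tfrac1{p'}=1$. Write $x=(x',x_n)\in\mathbb R^{n-1}\times\mathbb R$ and $\mathbb R^n_+=\{x_n>0\}$. For an open set $\Omega$ in $\mathbb R^m$, for $\sigma\in(0,1)$ and $1\le q<\infty$, set $$[f]_{W^{\sigma,q}(\Omega)}=\Big(\int_\Omega\int_\Omega\frac{|f(x)-f(y)|^q}{|x-y|^{m+\sigma q}}\,dx\,dy\Big)^{1/q},\qquad \|f\|_{W^{\sigma,q}(\Omega)}=\|f\|_{L^q(\Omega)}+[f]_{W^{\sigma,q}(\Omega)},$$ let $W^{\sigma,q}(\Omega)$ be the space of measurable $f$ for which this norm is finite, and let $W^{\sigma,q}_0(\Omega)$ be the space of those $f\in W^{\sigma,q}(\mathbb R^m)$ that vanish a.e. outside $\Omega$ (a function on $\Omega$ belongs to it if its extension by zero does). For $\varphi\in C_c^\infty(\Omega)$ set $$(-\Delta)^s_\Omega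 f[\varphi]=\int_\Omega\int_\Omega\frac{(f(x)-f(y))(\varphi(x)-\varphi(y))}{|x-y|^{m+2s}}\,dx\,dy,$$ and for $u:\mathbb R^n_+\to\mathbb R$ set $$[u]_{W^{\tilde s,p}_T(\mathbb R^n_+)}=\Big(\int_{\mathbb R^n_+}\int_{\mathbb R^n_+}\frac{|u(x',x_n)-u(y',x_n)|^p}{|x-y|^{n+\tilde sp}}\,dx\,dy\Big)^{1/p}.$$ Let $(-\Delta)^{t/2}$ be the operator on $\mathbb R^n$ with Fourier symbol $|\xi|^t$ (the identity if $t=0$). There is a constant $C$, depending only on $n,s,\tilde s,t,p$, such that the following holds. Let $G\in L^p(\mathbb R^n)$, let $u\in W^{s,2}(\mathbb R^n_+)$ with $[u]_{W_T^{\tilde s,p}(\mathbb R^n_+)}<\infty$, and assume that $$(-\Delta)^s_{\mathbb R^n_+}u[\varphi]=\int_{\mathbb R^n}G\,(-\Delta)^{t/2}\varphi\,dx\qquad\text{for all }\varphi\in C_c^\infty(\mathbb R^n_+).$$ Let $\eta\in C_c^\infty(\mathbb R^{n-1})$ and $v(x_n)=\int_{\mathbb R^{n-1}}u(z',x_n)\,\eta(z')\,dz'$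 for $x_n\in(0,\infty)$. Then $v\in W^{s,2}((0,\infty))$; if moreover $u\in W^{s,2}_0(\mathbb R^n_+)$, then $v\in W^{s,2}_0((0,\infty))$. Furthermore there is a linear functional $\tilde H$ on $W_0^{2s-\tilde s,p'}((0,\infty))$ such that $$(-\Delta)^s_{(0,\infty)}v[\psi]=\tilde H(\psi)\qquad\text{for all }\psi\in C_c^\infty((0,\infty))$$ and, for all $\psi\in W_0^{2s-\tilde s,p'}((0,\infty))$, $$|\tilde H(\psi)|\le C\big(\|G\|_{L^p(\mathbb R^n)}+[u]_{W_T^{\tilde s,p}(\mathbb R^n_+)}\big)\,\|\eta\|_{W^{2s-\tilde s,p'}(\mathbb R^{n-1})}\,\|\psi\|_{W^{2s-\tilde s,p'}((0,\infty))};$$ in particular $\tilde H\in\big(W_0^{2s-\tilde s,p'}((0,\infty))\big)^*$. -/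

import Mathlib

open MeasureTheory Set
open scoped ContDiff

/-- Euclidean space `ℝⁿ = ℝᵈ × ℝ`, `n = d + 1`, whose points are written `x = (x', xₙ)`; the norm is
the Euclidean one, `|x|² = |x'|² + xₙ²`, and the volume is Lebesgue measure. -/
abbrev Space (d : ℕ) : Type := WithLp 2 (EuclideanSpace ℝ (Fin d) × ℝ)

/-- The point `(x', xₙ)`. -/
def Space.mk {d : ℕ} (x' : EuclideanSpace ℝ (Fin d)) (r : ℝ) : Space d := WithLp.toLp 2 (x', r)

/-- The open upper half-space `ℝⁿ₊ = {xₙ > 0}`. -/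
def upperHalf (d : ℕ) : Set (Space d) := {x | 0 < x.snd}

section General

variable {V : Type*} [NormedAddCommGroup V] [NormedSpace ℝ V] [MeasureSpace V]

/-- `φ ∈ C_c^∞(Ω)`. -/
structure IsTest (Ω : Set V) (φ : V → ℝ) : Prop where
  smooth : ContDiff ℝ ∞ φ
  compact : HasCompactSupport φ
  support : tsupport φ ⊆ Ω

/-- The weak form of the regional fractional Laplacian of `u` on `Ω`, tested with `φ`:
`∫_Ω ∫_Ω (u(x) - u(y)) (φ(x) - φ(y)) / |x - y|^(dim + 2s) dx dy`. -/
noncomputable def regionalForm (s : ℝ) (Ω : Set V) (u φ : V → ℝ) : ℝ :=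
  ∫ z : V × V, (u z.1 - u z.2) * (φ z.1 - φ z.2) /
      ‖z.1 - z.2‖ ^ ((Module.finrank ℝ V : ℝ) + 2 * s)
    ∂((volume.restrict Ω).prod (volume.restrict Ω))

/-- The quotient `(f(x) - f(y)) / |x - y|^(dim/p + s)`, whose `p`-th power is
`|f(x) - f(y)|^p / |x - y|^(dim + sp)`. -/
noncomputable def diffQuot (s p : ℝ) (f : V → ℝ) (z : V × V) : ℝ :=
  (f z.1 - f z.2) / ‖z.1 - z.2‖ ^ ((Module.finrank ℝ V : ℝ) / p + s)

/-- The Gagliardo seminorm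
`[f]_{W^{s,p}(Ω)} = (∫_Ω ∫_Ω |f(x) - f(y)|^p / |x - y|^(dim + sp) dx dy)^(1/p)`. -/
noncomputable def sobolevSeminorm (s p : ℝ) (Ω : Set V) (f : V → ℝ) : ENNReal :=
  eLpNorm (diffQuot s p f) (ENNReal.ofReal p) ((volume.restrict Ω).prod (volume.restrict Ω))

/-- `‖f‖_{W^{s,p}(Ω)} = ‖f‖_{L^p(Ω)} + [f]_{W^{s,p}(Ω)}`. -/
noncomputable def sobolevNorm (s p : ℝ) (Ω : Set V) (f : V → ℝ) : ENNReal :=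
  eLpNorm f (ENNReal.ofReal p) (volume.restrict Ω) + sobolevSeminorm s p Ω f

/-- `f ∈ W^{s,p}(Ω)`: `f` is measurable on `Ω` and `‖f‖_{W^{s,p}(Ω)}` is finite. The values of `f`
outside `Ω` play no role. -/
def MemSobolev (s p : ℝ) (Ω : Set V) (f : V → ℝ) : Prop :=
  AEStronglyMeasurable f (volume.restrict Ω) ∧ sobolevNorm s p Ω f < ⊤

theorem MemSobolev.memLp_diffQuot [BorelSpace V] [SecondCountableTopology V]
    [SFinite (volume : Measure V)] {s p : ℝ} {Ω : Set V} {f : V → ℝ}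
    (hf : MemSobolev s p Ω f) :
    MemLp (diffQuot s p f) (ENNReal.ofReal p)
      ((volume.restrict Ω).prod (volume.restrict Ω)) := by
  refine ⟨?_, lt_of_le_of_lt le_add_self hf.2⟩
  have h : Measurable fun z : V × V =>
      ‖z.1 - z.2‖ ^ ((Module.finrank ℝ V : ℝ) / p + s) := by fun_prop
  exact ((hf.1.comp_fst.sub hf.1.comp_snd).aemeasurable.div h.aemeasurable).aestronglyMeasurable

theorem MemSobolev.of_memLp {s p : ℝ} {Ω : Set V} {f : V → ℝ}
    (h1 : MemLp f (ENNReal.ofReal p) (volume.restrict Ω))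
    (h2 : MemLp (diffQuot s p f) (ENNReal.ofReal p)
      ((volume.restrict Ω).prod (volume.restrict Ω))) :
    MemSobolev s p Ω f :=
  ⟨h1.1, ENNReal.add_lt_top.2 ⟨h1.2, h2.2⟩⟩

/-- `W₀^{s,p}(Ω)`: the functions in `W^{s,p}` of the whole space that vanish (almost everywhere)
outside `Ω`. -/
def sobolevZero [BorelSpace V] [SecondCountableTopology V] [SFinite (volume : Measure V)]
    (s p : ℝ) (Ω : Set V) : Submodule ℝ (V → ℝ) where
  carrier := {f | MemSobolev s p univ f ∧ ∀ᵐ x, x ∉ Ω → f x = 0}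
  zero_mem' := by
    have h : diffQuot s p (0 : V → ℝ) = 0 := by
      funext z
      simp [diffQuot]
    refine ⟨MemSobolev.of_memLp MemLp.zero ?_, by simp⟩
    rw [h]
    exact MemLp.zero
  add_mem' := by
    rintro f g ⟨hf, hf0⟩ ⟨hg, hg0⟩
    have h : diffQuot s p (f + g) = diffQuot s p f + diffQuot s p g := by
      funext z
      simp only [diffQuot, Pi.add_apply]
      ring
    refine ⟨MemSobolev.of_memLp ?_ ?_, ?_⟩
    · exact MemLp.add ⟨hf.1, lt_of_le_of_lt le_self_add hf.2⟩
        ⟨hg.1, lt_of_le_of_lt le_self_add hg.2⟩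
    · rw [h]
      exact hf.memLp_diffQuot.add hg.memLp_diffQuot
    · filter_upwards [hf0, hg0] with x h1 h2 hx
      simp [h1 hx, h2 hx]
  smul_mem' := by
    rintro c f ⟨hf, hf0⟩
    have h : diffQuot s p (c • f) = c • diffQuot s p f := by
      funext z
      simp only [diffQuot, Pi.smul_apply, smul_eq_mul]
      ring
    refine ⟨MemSobolev.of_memLp ?_ ?_, ?_⟩
    · exact MemLp.const_smul ⟨hf.1, lt_of_le_of_lt le_self_add hf.2⟩ c
    · rw [h]
      exact hf.memLp_diffQuot.const_smul c
    · filter_upwards [hf0] with x h1 hx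
      simp [h1 hx]

/-- The operator `(-Δ)^(t/2)` with Fourier symbol `|ξ|^t`, for `0 ≤ t < 1`, in integral form:
`c ∫ (φ(x) - φ(x+h)) / |h|^(dim + t) dh` with the usual constant
`c = 2^t Γ((dim + t)/2) / (π^(dim/2) |Γ(-t/2)|)` if `t > 0`, and the identity if `t = 0`. -/
noncomputable def fracDeriv (t : ℝ) (φ : V → ℝ) (x : V) : ℝ :=
  if t = 0 then φ x else
    2 ^ t * Real.Gamma (((Module.finrank ℝ V : ℝ) + t) / 2) /
        (Real.pi ^ ((Module.finrank ℝ V : ℝ) / 2) * |Real.Gamma (-t / 2)|) *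
      ∫ h : V, (φ x - φ (x + h)) / ‖h‖ ^ ((Module.finrank ℝ V : ℝ) + t)

end General

/-- The tangential seminorm `[u]_{W_T^{s,p}(ℝⁿ₊)}`, that is
`(∫_{ℝⁿ₊} ∫_{ℝⁿ₊} |u(x', xₙ) - u(y', xₙ)|^p / |x - y|^(n + sp) dx dy)^(1/p)`. -/
noncomputable def tangentialSeminorm {d : ℕ} (s p : ℝ) (u : Space d → ℝ) : ENNReal :=
  eLpNorm
    (fun z : Space d × Space d =>
      (u z.1 - u (Space.mk z.2.fst z.1.snd)) / ‖z.1 - z.2‖ ^ (((d : ℝ) + 1) / p + s))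
    (ENNReal.ofReal p)
    ((volume.restrict (upperHalf d)).prod (volume.restrict (upperHalf d)))

/-- The function `u` solves the regional equation with the right-hand side
`g[φ] = ∫ G (-Δ)^(t/2) φ` in `ℝⁿ₊`. -/
def SolvesHalfSpace {d : ℕ} (s t : ℝ) (G u : Space d → ℝ) : Prop :=
  ∀ φ : Space d → ℝ, IsTest (upperHalf d) φ →
    regionalForm s (upperHalf d) u φ = ∫ x, G x * fracDeriv t φ x

/-- `v(xₙ) = ∫ u(z', xₙ) η(z') dz'` for `xₙ > 0`, extended by zero to `xₙ ≤ 0`. -/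
noncomputable def tangentialAverage {d : ℕ} (u : Space d → ℝ)
    (η : EuclideanSpace ℝ (Fin d) → ℝ) : ℝ → ℝ :=
  (Ioi (0 : ℝ)).indicator fun r => ∫ z' : EuclideanSpace ℝ (Fin d), u (Space.mk z' r) * η z'

/-!
The equation is tested with tensor products `φ(x) = η(x') ψ(xₙ)`. Write `x = (x', a)`, `y = (y', b)`.
Exchanging `x'` and `y'`, and exchanging `a` and `b`, preserves the domain of integration and the
kernel. After symmetrization with respect to these two involutions all mixed differences of `u`
cancel, and one obtains an identity (`regionalForm_tensor`)

  `(-Δ)^s_{ℝⁿ₊} u[η ⊗ ψ] = c (-Δ)^s_{(0,∞)} v[ψ] + R(ψ)`,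

where `c > 0` is the constant that appears when `y'` is integrated out of `|x - y|^(-n-2s)`, and

  `R(ψ) = ∫∫ (η(x') - η(y')) (u(x', a) - u(y', a)) ψ(b) |x - y|^(-n-2s) dx dy`

contains only tangential differences of `u`. Put `σ = 2s - s'` and let `q = p'` be the conjugate
exponent. Hölder's inequality, followed by integration in `a`, gives
`|R(ψ)| ≤ C [u]_{W_T^{s',p}} [η]_{W^{σ,q}} ‖ψ‖_q` (`lintegral_remainderIntegrand_le`).

The term `∫ G (-Δ)^(t/2) (η ⊗ ψ)` is bounded by `‖G‖_p` times the `W^{τ,q}(ℝⁿ)`-norm of `η ⊗ ψ` for any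
`τ > t` (`enorm_integral_mul_fracDeriv_le`), which splits into norms of `η` and `ψ`
(`sobolevSeminorm_tensor_le`). Passing from the norm of `ψ` on the line to the one on `(0, ∞)` is the
fractional Hardy inequality (`hardyIntegral_le`), which fails only if `τq = 1`; since `t < σ`, the order
`τ ∈ (t, σ]` can be chosen so as to avoid this.

Hence the one-dimensional form of `v` is bounded on test functions by the `W^{σ,q}((0,∞))`-norm, and
the Hahn-Banach theorem extends it to the functional `H` (`exists_extension_regionalForm`).

That `v` belongs to `W^{s,2}`, and that the integrals above converge absolutely, follows from a slicing
estimate (`normalEnergy_le`): the normal differences of `u` are controlled by its full Gagliardo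
energy, on the half-space and, for the zero extension of `u`, on the whole space.
-/

open scoped ENNReal

/-! ### Gagliardo energies and homogeneous kernels -/

section Lebesgue

theorem eLpNorm_ofReal_rpow {X : Type*} [MeasurableSpace X] {μ : Measure X} {q : ℝ} (hq : 0 < q)
    (f : X → ℝ) : eLpNorm f (ENNReal.ofReal q) μ ^ q = ∫⁻ x, ‖f x‖ₑ ^ q ∂μ := by
  rw [eLpNorm_eq_lintegral_rpow_enorm_toReal (by simpa using hq) ENNReal.ofReal_ne_top,
    ENNReal.toReal_ofReal hq.le, ← ENNReal.rpow_mul, one_div_mul_cancel hq.ne', ENNReal.rpow_one]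

theorem eLpNorm_ofReal_eq {X : Type*} [MeasurableSpace X] {μ : Measure X} {q : ℝ} (hq : 0 < q)
    (f : X → ℝ) : eLpNorm f (ENNReal.ofReal q) μ = (∫⁻ x, ‖f x‖ₑ ^ q ∂μ) ^ (1 / q) := by
  rw [← eLpNorm_ofReal_rpow hq, ← ENNReal.rpow_mul, mul_one_div_cancel hq.ne', ENNReal.rpow_one]

theorem enorm_div_rpow {q : ℝ} (hq : 0 < q) (c r e : ℝ) (hr : 0 ≤ r) :
    ‖c / r ^ e‖ₑ ^ q = ‖c‖ₑ ^ q * ENNReal.ofReal (r ^ (-(e * q))) := by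
  rw [div_eq_mul_inv, ← Real.rpow_neg hr, enorm_mul, ENNReal.mul_rpow_of_nonneg _ _ hq.le,
    Real.enorm_of_nonneg (Real.rpow_nonneg hr _), ENNReal.ofReal_rpow_of_nonneg
      (Real.rpow_nonneg hr _) hq.le, ← Real.rpow_mul hr, neg_mul]

end Lebesgue

section Kernels

variable {V : Type*} [NormedAddCommGroup V]

/-- The homogeneous kernel `|z|^(-a)`, with values in `[0, ∞]`. The junk value at `z = 0` is `0`
(for `a ≠ 0`), which is harmless because the kernel is always multiplied by differences. -/
noncomputable def powKernel (a : ℝ) (z : V) : ℝ≥0∞ := ENNReal.ofReal (‖z‖ ^ (-a))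

/-- The part of a homogeneous kernel away from the origin. -/
noncomputable def farKernel (a : ℝ) : V → ℝ≥0∞ := (Metric.ball (0 : V) 1)ᶜ.indicator (powKernel a)

/-- Splitting a kernel at distance one: near the origin the singularity may be increased. -/
theorem powKernel_le_add_farKernel {a b : ℝ} (hab : a ≤ b) (ha : 0 < a) (z : V) :
    powKernel a z ≤ powKernel b z + farKernel a z := by
  by_cases hz : ‖z‖ < 1
  · refine le_add_right (ENNReal.ofReal_le_ofReal ?_)
    rcases (norm_nonneg z).eq_or_lt with h0 | h0
    · rw [← h0, Real.zero_rpow (by linarith), Real.zero_rpow (by linarith)]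
    · exact Real.rpow_le_rpow_of_exponent_ge h0 hz.le (by linarith)
  · simp [farKernel, indicator, hz]

variable [MeasureSpace V]

/-- The energy `∫_Ω ∫_Ω |f(x) - f(y)|^q k(x - y) dx dy` of `f` for the kernel `k`. -/
noncomputable def kernelEnergy (k : V → ℝ≥0∞) (q : ℝ) (Ω : Set V) (f : V → ℝ) : ℝ≥0∞ :=
  ∫⁻ z : V × V, ‖f z.1 - f z.2‖ₑ ^ q * k (z.1 - z.2)
    ∂((volume.restrict Ω).prod (volume.restrict Ω))

section

variable [BorelSpace V]

theorem measurable_powKernel (a : ℝ) : Measurable (powKernel a : V → ℝ≥0∞) := by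
  unfold powKernel; fun_prop

theorem measurable_farKernel (a : ℝ) : Measurable (farKernel a : V → ℝ≥0∞) :=
  (measurable_powKernel a).indicator measurableSet_ball.compl

theorem kernelEnergy_mono_add [SecondCountableTopology V] [SFinite (volume : Measure V)]
    {q : ℝ} {Ω : Set V} {f : V → ℝ}
    (hf : AEMeasurable f (volume.restrict Ω)) {k k₁ k₂ : V → ℝ≥0∞} (h₁ : Measurable k₁)
    (h : ∀ z, k z ≤ k₁ z + k₂ z) :
    kernelEnergy k q Ω f ≤ kernelEnergy k₁ q Ω f + kernelEnergy k₂ q Ω f := by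
  have hm : AEMeasurable (fun z : V × V => ‖f z.1 - f z.2‖ₑ ^ q * k₁ (z.1 - z.2))
      ((volume.restrict Ω).prod (volume.restrict Ω)) :=
    ((hf.comp_fst.sub hf.comp_snd).enorm.pow_const q).mul (by fun_prop)
  unfold kernelEnergy
  rw [← lintegral_add_left' hm]
  refine lintegral_mono fun z => ?_
  rw [← mul_add]
  gcongr
  exact h _

end

variable [NormedSpace ℝ V]

theorem sobolevSeminorm_rpow {τ q : ℝ} (hq : 0 < q) (Ω : Set V) (f : V → ℝ) :
    sobolevSeminorm τ q Ω f ^ q =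
      kernelEnergy (powKernel (Module.finrank ℝ V + τ * q)) q Ω f := by
  rw [sobolevSeminorm, eLpNorm_ofReal_rpow hq, kernelEnergy]
  refine lintegral_congr fun z => ?_
  rw [diffQuot, enorm_div_rpow hq _ _ _ (norm_nonneg _), powKernel]
  congr 4
  field_simp

theorem sobolevSeminorm_eq {τ q : ℝ} (hq : 0 < q) (Ω : Set V) (f : V → ℝ) :
    sobolevSeminorm τ q Ω f =
      kernelEnergy (powKernel (Module.finrank ℝ V + τ * q)) q Ω f ^ (1 / q) := by
  rw [← sobolevSeminorm_rpow hq, ← ENNReal.rpow_mul, mul_one_div_cancel hq.ne', ENNReal.rpow_one]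

variable [BorelSpace V]

variable [FiniteDimensional ℝ V] [(volume : Measure V).IsAddHaarMeasure]

theorem lintegral_mul_kernel_fst_le {Ω : Set V} {ρ : Measure V} [SFinite ρ] {g : V → ℝ≥0∞}
    (hg : AEMeasurable g ρ) {k : V → ℝ≥0∞} (hk : Measurable k) :
    ∫⁻ z : V × V, g z.1 * k (z.1 - z.2) ∂(ρ.prod (volume.restrict Ω)) ≤
      (∫⁻ z, k z) * ∫⁻ x, g x ∂ρ := by
  have hm : AEMeasurable (fun z : V × V => g z.1 * k (z.1 - z.2)) (ρ.prod (volume.restrict Ω)) :=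
    hg.comp_fst.mul (by fun_prop)
  rw [lintegral_prod _ hm, ← lintegral_const_mul'' _ hg]
  refine lintegral_mono fun x => ?_
  dsimp only
  rw [lintegral_const_mul _ (by fun_prop), mul_comm]
  refine mul_le_mul' ((setLIntegral_le_lintegral _ _).trans_eq ?_) le_rfl
  rw [lintegral_sub_left_eq_self (fun y => k y) x]

theorem lintegral_mul_kernel_snd_le {Ω : Set V} {ρ : Measure V} [SFinite ρ] {g : V → ℝ≥0∞}
    (hg : AEMeasurable g ρ) {k : V → ℝ≥0∞} (hk : Measurable k) :
    ∫⁻ z : V × V, g z.2 * k (z.1 - z.2) ∂((volume.restrict Ω).prod ρ) ≤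
      (∫⁻ z, k z) * ∫⁻ x, g x ∂ρ := by
  have hm : AEMeasurable (fun z : V × V => g z.2 * k (z.1 - z.2)) ((volume.restrict Ω).prod ρ) :=
    hg.comp_snd.mul (by fun_prop)
  rw [lintegral_prod_symm _ hm, ← lintegral_const_mul'' _ hg]
  refine lintegral_mono fun x => ?_
  dsimp only
  rw [lintegral_const_mul _ (by fun_prop), mul_comm]
  refine mul_le_mul' ((setLIntegral_le_lintegral _ _).trans_eq ?_) le_rfl
  rw [lintegral_sub_right_eq_self (fun y => k y) x]

/-- For an integrable kernel the energy is bounded by the `L^q`-norm alone. -/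
theorem kernelEnergy_le_of_integrable {q : ℝ} (hq : 1 ≤ q) {Ω : Set V} {f : V → ℝ}
    (hf : AEMeasurable f (volume.restrict Ω)) {k : V → ℝ≥0∞} (hk : Measurable k) :
    kernelEnergy k q Ω f ≤ 2 ^ q * (∫⁻ z, k z) * ∫⁻ x in Ω, ‖f x‖ₑ ^ q := by
  have hq0 : 0 < q := by linarith
  have key : ∀ z : V × V, ‖f z.1 - f z.2‖ₑ ^ q * k (z.1 - z.2) ≤
      2 ^ (q - 1) * (‖f z.1‖ₑ ^ q * k (z.1 - z.2)) + 2 ^ (q - 1) * (‖f z.2‖ₑ ^ q * k (z.1 - z.2)) := by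
    intro z
    rw [← mul_add, ← add_mul, ← mul_assoc]
    gcongr
    exact (ENNReal.rpow_le_rpow enorm_sub_le hq0.le).trans
      (ENNReal.rpow_add_le_mul_rpow_add_rpow _ _ hq)
  have hm1 : AEMeasurable (fun z : V × V => ‖f z.1‖ₑ ^ q * k (z.1 - z.2))
      ((volume.restrict Ω).prod (volume.restrict Ω)) :=
    ((hf.comp_fst.enorm).pow_const q).mul (by fun_prop)
  have hm2 : AEMeasurable (fun z : V × V => ‖f z.2‖ₑ ^ q * k (z.1 - z.2))
      ((volume.restrict Ω).prod (volume.restrict Ω)) :=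
    ((hf.comp_snd.enorm).pow_const q).mul (by fun_prop)
  have h1 := lintegral_mul_kernel_fst_le (Ω := Ω) (hf.enorm.pow_const q) hk
  have h2 := lintegral_mul_kernel_snd_le (Ω := Ω) (hf.enorm.pow_const q) hk
  calc kernelEnergy k q Ω f
      ≤ ∫⁻ z : V × V, (2 ^ (q - 1) * (‖f z.1‖ₑ ^ q * k (z.1 - z.2)) +
          2 ^ (q - 1) * (‖f z.2‖ₑ ^ q * k (z.1 - z.2)))
        ∂((volume.restrict Ω).prod (volume.restrict Ω)) := lintegral_mono key
    _ ≤ 2 ^ (q - 1) * ((∫⁻ z, k z) * ∫⁻ x in Ω, ‖f x‖ₑ ^ q) +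
        2 ^ (q - 1) * ((∫⁻ z, k z) * ∫⁻ x in Ω, ‖f x‖ₑ ^ q) := by
      rw [lintegral_add_left' (hm1.const_mul _), lintegral_const_mul'' _ hm1,
        lintegral_const_mul'' _ hm2]
      gcongr
    _ = 2 ^ q * (∫⁻ z, k z) * ∫⁻ x in Ω, ‖f x‖ₑ ^ q := by
      have : (2 : ℝ≥0∞) ^ q = 2 ^ (q - 1) * 2 := by
        conv_lhs => rw [show q = (q - 1) + 1 by ring]
        rw [ENNReal.rpow_add _ _ (by simp) (by simp), ENNReal.rpow_one]
      rw [this]; ring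

theorem lintegral_powKernel_near [Nontrivial V] {a : ℝ} (ha : a < Module.finrank ℝ V) :
    ∫⁻ z in Metric.ball (0 : V) 1, powKernel a z < ⊤ := by
  have hn : 0 < Module.finrank ℝ V := Module.finrank_pos
  have h := (integrable_fun_norm_addHaar (volume : Measure V)
    (f := (Iio (1 : ℝ)).indicator fun r => r ^ (-a))).2 ?_
  · refine lt_of_eq_of_lt ?_ h.2
    rw [← lintegral_indicator measurableSet_ball]
    refine lintegral_congr fun z => ?_
    by_cases hz : ‖z‖ < 1
    · simp [indicator, hz, powKernel, Real.enorm_of_nonneg (Real.rpow_nonneg (norm_nonneg z) _)]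
    · simp [indicator, hz]
  · have h1 : IntegrableOn (fun r : ℝ => r ^ ((Module.finrank ℝ V : ℝ) - 1 - a)) (Ioo 0 1) := by
      rw [← integrableOn_Ioc_iff_integrableOn_Ioo, ← intervalIntegrable_iff_integrableOn_Ioc_of_le zero_le_one]
      exact intervalIntegral.intervalIntegrable_rpow' (by linarith)
    rw [← integrable_indicator_iff measurableSet_Ioo] at h1
    rw [← integrable_indicator_iff measurableSet_Ioi]
    refine h1.congr (Filter.Eventually.of_forall fun r => ?_)
    by_cases h0 : 0 < r
    · by_cases hr : r < 1
      · have : r ^ (Module.finrank ℝ V - 1) = r ^ ((Module.finrank ℝ V : ℝ) - 1) := by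
          rw [← Real.rpow_natCast, Nat.cast_sub hn, Nat.cast_one]
        simp [indicator, h0, hr, this, sub_eq_add_neg, Real.rpow_add h0]
      · simp [indicator, h0, hr]
    · simp [indicator, h0]

theorem lintegral_powKernel_far {a : ℝ} (ha : Module.finrank ℝ V < a) :
    ∫⁻ z in (Metric.ball (0 : V) 1)ᶜ, powKernel a z < ⊤ := by
  have h := integrable_rpow_neg_one_add_norm_sq (μ := (volume : Measure V)) ha
  have ha0 : 0 < a := lt_of_le_of_lt (Nat.cast_nonneg _) ha
  have h2 : ∫⁻ z : V, ENNReal.ofReal (2 ^ (a / 2)) * ENNReal.ofReal ((1 + ‖z‖ ^ 2) ^ (-a / 2)) < ⊤ := by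
    rw [lintegral_const_mul _ (by fun_prop)]
    exact ENNReal.mul_lt_top ENNReal.ofReal_lt_top h.lintegral_lt_top
  refine lt_of_le_of_lt ?_ h2
  refine (setLIntegral_mono' measurableSet_ball.compl fun z hz => ?_).trans
    (setLIntegral_le_lintegral _ _)
  have hz : 1 ≤ ‖z‖ := by simpa using hz
  rw [powKernel, ← ENNReal.ofReal_mul (by positivity)]
  refine ENNReal.ofReal_le_ofReal ?_
  have hz0 : 0 < ‖z‖ := by linarith
  have e1 : ‖z‖ ^ (-a) = (‖z‖ ^ 2) ^ (-a / 2) := by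
    rw [← Real.rpow_natCast, ← Real.rpow_mul hz0.le]; congr 1; push_cast; ring
  have e2 : (2 : ℝ) ^ (a / 2) * (1 + ‖z‖ ^ 2) ^ (-a / 2) = ((1 + ‖z‖ ^ 2) / 2) ^ (-a / 2) := by
    rw [Real.div_rpow (by positivity) (by positivity), neg_div, Real.rpow_neg (by positivity) (x := 2)]
    field_simp
  rw [e1, e2]
  refine Real.rpow_le_rpow_of_nonpos (by positivity) (by nlinarith) (by linarith)

/-- Scaling: `∫ (|z|² + h²)^(-α/2) dz` is a finite constant times `h^(dim - α)`. -/
theorem lintegral_add_sq_rpow (α : ℝ) {h : ℝ} (hh : 0 < h) :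
    ∫⁻ z : V, ENNReal.ofReal ((‖z‖ ^ 2 + h ^ 2) ^ (-α / 2)) =
      ENNReal.ofReal (h ^ ((Module.finrank ℝ V : ℝ) - α)) *
        ∫⁻ z : V, ENNReal.ofReal ((1 + ‖z‖ ^ 2) ^ (-α / 2)) := by
  have hm : Measurable fun z : V => ENNReal.ofReal ((‖z‖ ^ 2 + h ^ 2) ^ (-α / 2)) := by fun_prop
  have h1 : ∫⁻ z : V, ENNReal.ofReal ((‖h • z‖ ^ 2 + h ^ 2) ^ (-α / 2)) =
      ENNReal.ofReal (h ^ (-(Module.finrank ℝ V : ℝ))) *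
        ∫⁻ z : V, ENNReal.ofReal ((‖z‖ ^ 2 + h ^ 2) ^ (-α / 2)) := by
    rw [← lintegral_map hm (measurable_const_smul h), Measure.map_addHaar_smul _ hh.ne',
      lintegral_smul_measure, smul_eq_mul, abs_of_pos (by positivity), Real.rpow_neg hh.le,
      Real.rpow_natCast]
  have h2 : ∀ z : V, ENNReal.ofReal ((‖h • z‖ ^ 2 + h ^ 2) ^ (-α / 2)) =
      ENNReal.ofReal (h ^ (-α)) * ENNReal.ofReal ((1 + ‖z‖ ^ 2) ^ (-α / 2)) := by
    intro z
    rw [← ENNReal.ofReal_mul (by positivity)]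
    congr 1
    rw [norm_smul, Real.norm_of_nonneg hh.le, show (h * ‖z‖) ^ 2 + h ^ 2 = h ^ 2 * (1 + ‖z‖ ^ 2) by ring,
      Real.mul_rpow (by positivity) (by positivity), ← Real.rpow_natCast h 2, ← Real.rpow_mul hh.le]
    congr 2
    push_cast; ring
  simp_rw [h2] at h1
  rw [lintegral_const_mul _ (by fun_prop)] at h1
  rw [sub_eq_add_neg, Real.rpow_add hh, ENNReal.ofReal_mul (by positivity), mul_assoc, h1, ← mul_assoc,
    ← ENNReal.ofReal_mul (by positivity), ← Real.rpow_add hh, add_neg_cancel, Real.rpow_zero,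
    ENNReal.ofReal_one, one_mul]

theorem lintegral_one_add_sq_rpow_lt_top {α : ℝ} (hα : Module.finrank ℝ V < α) :
    ∫⁻ z : V, ENNReal.ofReal ((1 + ‖z‖ ^ 2) ^ (-α / 2)) < ⊤ :=
  (integrable_rpow_neg_one_add_norm_sq (μ := (volume : Measure V)) hα).lintegral_lt_top

theorem lintegral_farKernel_lt_top {a : ℝ} (ha : Module.finrank ℝ V < a) :
    ∫⁻ z, farKernel a (z : V) < ⊤ := by
  rw [farKernel, lintegral_indicator measurableSet_ball.compl]
  exact lintegral_powKernel_far ha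

/-- Lowering the order of differentiability: `[f]_{W^{τ,q}(Ω)} ≤ C ‖f‖_{W^{σ,q}(Ω)}`. -/
theorem sobolevSeminorm_le_of_le {τ σ q : ℝ} (hτ : 0 < τ) (hτσ : τ ≤ σ) (hq : 1 ≤ q) :
    ∃ C : ℝ≥0∞, C < ⊤ ∧ ∀ (Ω : Set V) (f : V → ℝ), AEMeasurable f (volume.restrict Ω) →
      sobolevSeminorm τ q Ω f ≤ C * sobolevNorm σ q Ω f := by
  have hq0 : 0 < q := by linarith
  set n : ℝ := (Module.finrank ℝ V : ℝ) with hn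
  have hn0 : 0 ≤ n := Nat.cast_nonneg _
  have hfar : ∫⁻ z, farKernel (n + τ * q) (z : V) < ⊤ :=
    lintegral_farKernel_lt_top (by rw [← hn]; nlinarith)
  set K := 2 ^ q * ∫⁻ z, farKernel (n + τ * q) (z : V)
  have hKt : K < ⊤ := ENNReal.mul_lt_top
    (ENNReal.rpow_lt_top_of_nonneg hq0.le (by simp)) hfar
  refine ⟨1 + K ^ (1 / q), ENNReal.add_lt_top.2 ⟨ENNReal.one_lt_top,
    ENNReal.rpow_lt_top_of_nonneg (by positivity) hKt.ne⟩, fun Ω f hf => ?_⟩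
  rw [sobolevSeminorm_eq hq0]
  have h1 : kernelEnergy (powKernel (n + τ * q)) q Ω f ≤
      sobolevSeminorm σ q Ω f ^ q + K * eLpNorm f (ENNReal.ofReal q) (volume.restrict Ω) ^ q := by
    rw [sobolevSeminorm_rpow hq0, eLpNorm_ofReal_rpow hq0]
    refine (kernelEnergy_mono_add hf (measurable_powKernel _)
      (powKernel_le_add_farKernel (b := n + σ * q) (by nlinarith) (by nlinarith))).trans ?_
    gcongr
    exact kernelEnergy_le_of_integrable hq hf (measurable_farKernel _)
  refine (ENNReal.rpow_le_rpow h1 (by positivity)).trans ?_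
  refine (ENNReal.rpow_add_le_add_rpow _ _ (by positivity) (by rw [div_le_one hq0]; exact hq)).trans ?_
  rw [ENNReal.mul_rpow_of_nonneg _ _ (by positivity), ← ENNReal.rpow_mul, ← ENNReal.rpow_mul,
    mul_one_div_cancel hq0.ne', ENNReal.rpow_one, ENNReal.rpow_one, sobolevNorm, mul_add, add_mul, add_mul,
    one_mul, one_mul]
  rw [add_comm]
  exact add_le_add le_add_self le_self_add

end Kernels

/-! ### Test functions, and duality for the fractional derivative -/

section FunctionSpaces

variable {V : Type*} [NormedAddCommGroup V] [NormedSpace ℝ V] [MeasureSpace V] [BorelSpace V]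
  [FiniteDimensional ℝ V] [(volume : Measure V).IsAddHaarMeasure]

/-- The part of a homogeneous kernel near the origin. -/
noncomputable def nearKernel {V : Type*} [NormedAddCommGroup V] (a : ℝ) : V → ℝ≥0∞ :=
  (Metric.ball (0 : V) 1).indicator (powKernel a)

omit [NormedSpace ℝ V] [FiniteDimensional ℝ V] [(volume : Measure V).IsAddHaarMeasure] in
theorem measurable_nearKernel (a : ℝ) : Measurable (nearKernel a : V → ℝ≥0∞) :=
  (measurable_powKernel a).indicator measurableSet_ball

theorem lintegral_nearKernel_lt_top [Nontrivial V] {a : ℝ} (ha : a < Module.finrank ℝ V) :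
    ∫⁻ z, nearKernel a (z : V) < ⊤ := by
  rw [nearKernel, lintegral_indicator measurableSet_ball]
  exact lintegral_powKernel_near ha

/-- Test functions belong to `W^{τ,q}`: away from the diagonal the kernel is integrable, and near it
the Lipschitz bound lowers the singularity to the integrable exponent `dim + τq - q`. -/
theorem IsTest.memSobolev [Nontrivial V] {Ω : Set V} {f : V → ℝ} (hf : IsTest Ω f) {τ q : ℝ}
    (hτ : 0 < τ) (hτ1 : τ < 1) (hq : 1 ≤ q) : MemSobolev τ q univ f := by
  have hq0 : 0 < q := by linarith
  have hc : Continuous f := hf.smooth.continuous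
  have hLp : MemLp f (ENNReal.ofReal q) volume := hc.memLp_of_hasCompactSupport hf.compact
  refine ⟨hc.aestronglyMeasurable, ?_⟩
  rw [sobolevNorm, Measure.restrict_univ]
  refine ENNReal.add_lt_top.2 ⟨hLp.2, ?_⟩
  rw [sobolevSeminorm_eq hq0]
  refine ENNReal.rpow_lt_top_of_nonneg (by positivity) (ne_of_lt ?_)
  obtain ⟨L, hL⟩ := hf.smooth.lipschitzWith_of_hasCompactSupport hf.compact (by simp)
  set n : ℝ := (Module.finrank ℝ V : ℝ) with hn
  have hn0 : 0 ≤ n := Nat.cast_nonneg _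
  have hfar := kernelEnergy_le_of_integrable hq (Ω := univ) hc.aemeasurable
    (measurable_farKernel (V := V) (n + τ * q))
  have hfar' : kernelEnergy (farKernel (n + τ * q)) q univ f < ⊤ := by
    refine hfar.trans_lt (ENNReal.mul_lt_top (ENNReal.mul_lt_top
      (ENNReal.rpow_lt_top_of_nonneg hq0.le (by simp))
      (lintegral_farKernel_lt_top (by rw [← hn]; nlinarith))) ?_)
    rw [Measure.restrict_univ, ← eLpNorm_ofReal_rpow hq0]
    exact ENNReal.rpow_lt_top_of_nonneg hq0.le hLp.2.ne
  -- near the diagonal, `|f(x) - f(y)|^q` gains the factor `|x - y|^q`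
  set S := tsupport f
  have hS : MeasurableSet S := (isClosed_tsupport f).measurableSet
  set g : V → ℝ≥0∞ := S.indicator 1 with hg
  have hgm : Measurable g := measurable_one.indicator hS
  set k₁ : V → ℝ≥0∞ := nearKernel (n + τ * q - q) with hk1
  have hk1m : Measurable k₁ := measurable_nearKernel _
  have hbound : ∀ z : V × V, ‖f z.1 - f z.2‖ₑ ^ q * powKernel (n + τ * q) (z.1 - z.2) ≤
      (L : ℝ≥0∞) ^ q * (g z.1 * k₁ (z.1 - z.2)) + (L : ℝ≥0∞) ^ q * (g z.2 * k₁ (z.1 - z.2)) +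
        ‖f z.1 - f z.2‖ₑ ^ q * farKernel (n + τ * q) (z.1 - z.2) := by
    rintro ⟨x, y⟩
    dsimp only
    by_cases hxy : ‖x - y‖ < 1
    · refine le_add_right ?_
      rcases (norm_nonneg (x - y)).eq_or_lt with h0 | h0
      · have : x = y := by rw [eq_comm, norm_eq_zero, sub_eq_zero] at h0; exact h0
        simp [this, hq0]
      by_cases hmem : x ∈ S ∨ y ∈ S
      · have h1 : ‖f x - f y‖ₑ ^ q * powKernel (n + τ * q) (x - y) ≤
            (L : ℝ≥0∞) ^ q * k₁ (x - y) := by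
          have e1 : ‖f x - f y‖ₑ ≤ L * ENNReal.ofReal ‖x - y‖ := by
            have := hL x y
            rwa [edist_eq_enorm_sub, edist_eq_enorm_sub, ← ofReal_norm (x - y)] at this
          calc _ ≤ (L * ENNReal.ofReal ‖x - y‖) ^ q * powKernel (n + τ * q) (x - y) := by gcongr
            _ = _ := by
              have : x - y ∈ Metric.ball (0 : V) 1 := by simpa using hxy
              rw [ENNReal.mul_rpow_of_nonneg _ _ hq0.le, mul_assoc, hk1, nearKernel,
                indicator_of_mem this, powKernel, powKernel, ENNReal.ofReal_rpow_of_pos h0,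
                ← ENNReal.ofReal_mul (by positivity), ← Real.rpow_add h0]
              congr 4
              ring
        rcases hmem with h | h
        · refine le_add_right (h1.trans ?_)
          simp [hg, h]
        · refine le_add_left (h1.trans ?_)
          simp [hg, h]
      · push Not at hmem
        simp [image_eq_zero_of_notMem_tsupport hmem.1, image_eq_zero_of_notMem_tsupport hmem.2, hq0]
    · refine le_add_left ?_
      simp [farKernel, indicator, hxy]
  have hSfin : ∫⁻ x, g x < ⊤ := by
    rw [hg, lintegral_indicator_one hS]
    exact hf.compact.measure_lt_top
  have hkfin : ∫⁻ z, k₁ z < ⊤ := lintegral_nearKernel_lt_top (by rw [← hn]; nlinarith)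
  have hA := (lintegral_mul_kernel_fst_le (Ω := univ) (ρ := volume.restrict univ) hgm.aemeasurable hk1m)
  have hB := (lintegral_mul_kernel_snd_le (Ω := univ) (ρ := volume.restrict univ) hgm.aemeasurable hk1m)
  have hLfin : (L : ℝ≥0∞) ^ q < ⊤ := ENNReal.rpow_lt_top_of_nonneg hq0.le (by simp)
  refine (lintegral_mono hbound).trans_lt ?_
  rw [lintegral_add_left (by fun_prop), lintegral_add_left (by fun_prop),
    lintegral_const_mul _ (by fun_prop), lintegral_const_mul _ (by fun_prop)]
  rw [Measure.restrict_univ] at hA hB ⊢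
  have hfin := ENNReal.mul_lt_top hkfin hSfin
  refine ENNReal.add_lt_top.2 ⟨ENNReal.add_lt_top.2
    ⟨ENNReal.mul_lt_top hLfin (hA.trans_lt hfin), ENNReal.mul_lt_top hLfin (hB.trans_lt hfin)⟩, ?_⟩
  rw [kernelEnergy, Measure.restrict_univ] at hfar'
  exact hfar'

/-- Hölder's inequality for a difference paired with `G(x)` through a product of kernels in the
variable `x - y`. -/
theorem lintegral_mul_sub_le {p q : ℝ} (hpq : p.HolderConjugate q) {G φ : V → ℝ}
    (hG : AEMeasurable G volume) (hφ : AEMeasurable φ volume) {a b : V → ℝ≥0∞} (ha : Measurable a)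
    (hb : Measurable b) :
    ∫⁻ z : V × V, ‖G z.1‖ₑ * ‖φ z.1 - φ z.2‖ₑ * (a (z.1 - z.2) ^ (1 / p) * b (z.1 - z.2) ^ (1 / q))
      ∂(volume.prod volume) ≤
    (∫⁻ z, a z) ^ (1 / p) * eLpNorm G (ENNReal.ofReal p) volume *
      kernelEnergy b q univ φ ^ (1 / q) := by
  have hp0 := hpq.pos
  have hq0 := hpq.symm.pos
  have hm1 : AEMeasurable (fun z : V × V => ‖G z.1‖ₑ * a (z.1 - z.2) ^ (1 / p))
      ((volume : Measure V).prod volume) := hG.comp_fst.enorm.mul (by fun_prop)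
  have hm2 : AEMeasurable (fun z : V × V => ‖φ z.1 - φ z.2‖ₑ * b (z.1 - z.2) ^ (1 / q))
      ((volume : Measure V).prod volume) := (hφ.comp_fst.sub hφ.comp_snd).enorm.mul (by fun_prop)
  have h := ENNReal.lintegral_mul_le_Lp_mul_Lq _ hpq hm1 hm2
  refine (le_of_eq ?_).trans (h.trans ?_)
  · refine lintegral_congr fun z => ?_
    simp only [Pi.mul_apply]; ring
  · refine mul_le_mul' ?_ (le_of_eq ?_)
    · rw [eLpNorm_ofReal_eq hp0, ← ENNReal.mul_rpow_of_nonneg _ _ (by positivity)]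
      gcongr
      simp_rw [ENNReal.mul_rpow_of_nonneg _ _ hp0.le, ← ENNReal.rpow_mul, one_div_mul_cancel hp0.ne',
        ENNReal.rpow_one]
      have := lintegral_mul_kernel_fst_le (Ω := univ) (hG.enorm.pow_const p) ha
      rwa [Measure.restrict_univ] at this
    · rw [kernelEnergy, Measure.restrict_univ]
      simp_rw [ENNReal.mul_rpow_of_nonneg _ _ hq0.le, ← ENNReal.rpow_mul, one_div_mul_cancel hq0.ne',
        ENNReal.rpow_one]

omit [FiniteDimensional ℝ V] in
theorem enorm_fracDeriv_le {t : ℝ} (ht : t ≠ 0) :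
    ∃ c : ℝ≥0∞, c < ⊤ ∧ ∀ (φ : V → ℝ), Measurable φ → ∀ x,
      ‖fracDeriv t φ x‖ₑ ≤ c * ∫⁻ y, ‖φ x - φ y‖ₑ *
        powKernel ((Module.finrank ℝ V : ℝ) + t) (x - y) := by
  refine ⟨‖2 ^ t * Real.Gamma (((Module.finrank ℝ V : ℝ) + t) / 2) /
    (Real.pi ^ ((Module.finrank ℝ V : ℝ) / 2) * |Real.Gamma (-t / 2)|)‖ₑ, enorm_lt_top,
    fun φ hφ x => ?_⟩
  · rw [fracDeriv, if_neg ht, enorm_mul]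
    gcongr
    refine (enorm_integral_le_lintegral_enorm _).trans_eq ?_
    rw [← lintegral_add_left_eq_self (fun y => ‖φ x - φ y‖ₑ *
      powKernel ((Module.finrank ℝ V : ℝ) + t) (x - y)) x]
    refine lintegral_congr fun h => ?_
    rw [div_eq_mul_inv, enorm_mul, ← Real.rpow_neg (norm_nonneg _),
      Real.enorm_of_nonneg (Real.rpow_nonneg (norm_nonneg h) _), powKernel]
    simp

/-- Duality bound for the operator `(-Δ)^(t/2)`: its pairing with `G ∈ L^p` is controlled by the
`W^{τ,q}`-norm of any order `τ > t`. -/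
theorem enorm_integral_mul_fracDeriv_le [Nontrivial V] {p q t τ : ℝ} (hpq : p.HolderConjugate q)
    (ht : 0 ≤ t) (htτ : t < τ) :
    ∃ C : ℝ≥0∞, C < ⊤ ∧ ∀ G φ : V → ℝ, AEMeasurable G volume → Measurable φ →
      ‖∫ x, G x * fracDeriv t φ x‖ₑ ≤
        C * eLpNorm G (ENNReal.ofReal p) volume * sobolevNorm τ q univ φ := by
  have hp0 := hpq.pos
  have hq0 := hpq.symm.pos
  have hq1 := hpq.symm.lt
  rcases ht.eq_or_lt with rfl | ht0
  · refine ⟨1, ENNReal.one_lt_top, fun G φ hG hφ => ?_⟩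
    refine (enorm_integral_le_lintegral_enorm _).trans ?_
    simp only [fracDeriv, if_true, enorm_mul]
    refine (ENNReal.lintegral_mul_le_Lp_mul_Lq _ hpq hG.enorm hφ.enorm.aemeasurable).trans ?_
    rw [one_mul, sobolevNorm, Measure.restrict_univ, eLpNorm_ofReal_eq hp0, eLpNorm_ofReal_eq hq0]
    exact mul_le_mul' le_rfl le_self_add
  set n : ℝ := (Module.finrank ℝ V : ℝ) with hn
  have hn0 : 0 < n := Nat.cast_pos.2 Module.finrank_pos
  obtain ⟨c, hc, hfrac⟩ := enorm_fracDeriv_le (V := V) ht0.ne'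
  set a₁ : V → ℝ≥0∞ := nearKernel (n - (τ - t) * p) with ha1
  have ha1m : Measurable a₁ := measurable_nearKernel _
  have ha1f : ∫⁻ z, a₁ z < ⊤ := lintegral_nearKernel_lt_top (by rw [← hn]; nlinarith)
  set k₂ : V → ℝ≥0∞ := farKernel (n + t) with hk2
  have hk2m : Measurable k₂ := measurable_farKernel _
  have hk2f : ∫⁻ z, k₂ z < ⊤ := lintegral_farKernel_lt_top (by rw [← hn]; linarith)
  set A₁ := (∫⁻ z, a₁ z) ^ (1 / p)
  set A₂ := (∫⁻ z, k₂ z) ^ (1 / p)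
  set B₂ := (2 ^ q * ∫⁻ z, k₂ z) ^ (1 / q) with hB2
  have hpi : 0 ≤ 1 / p := by positivity
  have hqi : 0 ≤ 1 / q := by positivity
  have hA1f : A₁ < ⊤ := ENNReal.rpow_lt_top_of_nonneg hpi ha1f.ne
  have hA2f : A₂ < ⊤ := ENNReal.rpow_lt_top_of_nonneg hpi hk2f.ne
  have hB2f : B₂ < ⊤ := ENNReal.rpow_lt_top_of_nonneg hqi (ENNReal.mul_lt_top
    (ENNReal.rpow_lt_top_of_nonneg hq0.le (by simp)) hk2f).ne
  refine ⟨c * (A₁ + A₂ * B₂), ENNReal.mul_lt_top hc (ENNReal.add_lt_top.2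
    ⟨hA1f, ENNReal.mul_lt_top hA2f hB2f⟩), fun G φ hG hφ => ?_⟩
  have hker : ∀ z : V, powKernel (n + t) z ≤
      a₁ z ^ (1 / p) * powKernel (n + τ * q) z ^ (1 / q) + k₂ z ^ (1 / p) * k₂ z ^ (1 / q) := by
    intro z
    by_cases hz : ‖z‖ < 1
    · refine le_add_right ?_
      rcases (norm_nonneg z).eq_or_lt with h0 | h0
      · rw [powKernel, ← h0, Real.zero_rpow (by linarith), ENNReal.ofReal_zero]
        exact bot_le
      · have : z ∈ Metric.ball (0 : V) 1 := by simpa using hz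
        rw [ha1, nearKernel, indicator_of_mem this]
        simp only [powKernel]
        rw [ENNReal.ofReal_rpow_of_pos (by positivity), ENNReal.ofReal_rpow_of_pos (by positivity),
          ← ENNReal.ofReal_mul (by positivity), ← Real.rpow_mul h0.le, ← Real.rpow_mul h0.le,
          ← Real.rpow_add h0]
        refine le_of_eq ?_
        congr 2
        have h1 := hpq.inv_add_inv_eq_one
        field_simp at h1 ⊢
        linear_combination (n) * h1
    · refine le_add_left ?_
      have h1 : 1 / p + 1 / q = 1 := by simpa using hpq.inv_add_inv_eq_one
      rw [← ENNReal.rpow_add_of_nonneg _ _ hpi hqi, h1, ENNReal.rpow_one]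
      simp [hk2, farKernel, hz]
  have hfarE : kernelEnergy k₂ q univ φ ^ (1 / q) ≤ B₂ * eLpNorm φ (ENNReal.ofReal q) volume := by
    rw [eLpNorm_ofReal_eq hq0, hB2, ← ENNReal.mul_rpow_of_nonneg _ _ hqi]
    gcongr
    have := kernelEnergy_le_of_integrable hq1.le (Ω := univ) hφ.aemeasurable hk2m
    rwa [Measure.restrict_univ] at this
  have hN := lintegral_mul_sub_le hpq hG hφ.aemeasurable ha1m (measurable_powKernel (V := V) (n + τ * q))
  have hF := lintegral_mul_sub_le hpq hG hφ.aemeasurable hk2m hk2m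
  rw [← sobolevSeminorm_eq hq0] at hN
  have hmeas : AEMeasurable (fun z : V × V => ‖G z.1‖ₑ * (‖φ z.1 - φ z.2‖ₑ * powKernel (n + t) (z.1 - z.2)))
      ((volume : Measure V).prod volume) := by
    have := measurable_powKernel (V := V) (n + t)
    exact hG.comp_fst.enorm.mul (by fun_prop)
  calc ‖∫ x, G x * fracDeriv t φ x‖ₑ
      ≤ ∫⁻ x, ‖G x‖ₑ * (c * ∫⁻ y, ‖φ x - φ y‖ₑ * powKernel (n + t) (x - y)) := by
        refine (enorm_integral_le_lintegral_enorm _).trans (lintegral_mono fun x => ?_)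
        rw [enorm_mul]
        exact mul_le_mul' le_rfl (hfrac φ hφ x)
    _ = c * ∫⁻ z : V × V, ‖G z.1‖ₑ * (‖φ z.1 - φ z.2‖ₑ * powKernel (n + t) (z.1 - z.2))
          ∂(volume.prod volume) := by
        rw [lintegral_prod _ hmeas, ← lintegral_const_mul' _ _ hc.ne]
        refine lintegral_congr fun x => ?_
        have := measurable_powKernel (V := V) (n + t)
        dsimp only
        rw [lintegral_const_mul _ (by fun_prop)]
        ring
    _ ≤ c * (A₁ * eLpNorm G (ENNReal.ofReal p) volume * sobolevSeminorm τ q univ φ +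
          A₂ * eLpNorm G (ENNReal.ofReal p) volume * (B₂ * eLpNorm φ (ENNReal.ofReal q) volume)) := by
        gcongr
        refine le_trans ?_ (add_le_add hN (hF.trans (mul_le_mul' le_rfl hfarE)))
        rw [← lintegral_add_left']
        · refine lintegral_mono fun z => ?_
          rw [← mul_add, mul_assoc]
          gcongr
          exact hker _
        · have := measurable_powKernel (V := V) (n + τ * q)
          exact (hG.comp_fst.enorm.mul (by fun_prop)).mul (by fun_prop)
    _ ≤ _ := by
        rw [sobolevNorm, Measure.restrict_univ]
        set g := eLpNorm G (ENNReal.ofReal p) volume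
        set f := eLpNorm φ (ENNReal.ofReal q) volume
        set w := sobolevSeminorm τ q univ φ
        calc _ = c * (A₁ * g * w) + c * (A₂ * B₂) * g * f := by ring
          _ ≤ c * (A₁ * g * (f + w)) + c * (A₂ * B₂) * g * (f + w) := by
            gcongr
            · exact le_add_self
            · exact le_self_add
          _ = _ := by ring

end FunctionSpaces

/-! ### Hardy's inequality and extension by zero on the half-line -/

section HalfLine

theorem lintegral_comp_mul_left_pos {a : ℝ} (ha : 0 < a) {F : ℝ → ℝ≥0∞} (hF : Measurable F) :
    ∫⁻ x, F (a * x) = ENNReal.ofReal a⁻¹ * ∫⁻ x, F x := by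
  rw [← lintegral_map hF (measurable_const_mul a), Real.map_volume_mul_left ha.ne',
    lintegral_smul_measure, abs_of_pos (by positivity), smul_eq_mul]

/-- The weighted integral `∫_0^∞ |ψ(x)|^q x^(-τq) dx` of Hardy's inequality. -/
noncomputable def hardyIntegral (τ q : ℝ) (ψ : ℝ → ℝ) : ℝ≥0∞ :=
  ∫⁻ x in Ioi 0, ‖ψ x‖ₑ ^ q * ENNReal.ofReal (x ^ (-(τ * q)))

theorem IsTest.eq_zero_of_notMem {V : Type*} [NormedAddCommGroup V] [NormedSpace ℝ V] {Ω : Set V}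
    {f : V → ℝ} (hf : IsTest Ω f) {x : V} (hx : x ∉ Ω) : f x = 0 :=
  image_eq_zero_of_notMem_tsupport fun h => hx (hf.support h)

theorem hardyIntegral_lt_top {τ q : ℝ} (hτ : 0 < τ) (hq : 1 ≤ q) {ψ : ℝ → ℝ}
    (hψ : IsTest (Ioi 0) ψ) : hardyIntegral τ q ψ < ⊤ := by
  have hq0 : 0 < q := by linarith
  obtain ⟨δ, hδ, hδ'⟩ : ∃ δ > 0, ∀ x, 0 < x → x < δ → ψ x = 0 := by
    have h : (tsupport ψ)ᶜ ∈ nhds (0 : ℝ) :=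
      (isClosed_tsupport ψ).isOpen_compl.mem_nhds fun h =>
        absurd (hψ.support h) (lt_irrefl (0 : ℝ))
    obtain ⟨δ, hδ, h⟩ := Metric.mem_nhds_iff.1 h
    refine ⟨δ, hδ, fun x h0 hx => image_eq_zero_of_notMem_tsupport (h ?_)⟩
    simpa [abs_of_pos h0] using hx
  have hLp : MemLp ψ (ENNReal.ofReal q) volume :=
    hψ.smooth.continuous.memLp_of_hasCompactSupport hψ.compact
  have h1 : ∫⁻ x, ‖ψ x‖ₑ ^ q * ENNReal.ofReal (δ ^ (-(τ * q))) < ⊤ := by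
    rw [lintegral_mul_const' _ _ ENNReal.ofReal_ne_top, ← eLpNorm_ofReal_rpow hq0]
    exact ENNReal.mul_lt_top (ENNReal.rpow_lt_top_of_nonneg hq0.le hLp.2.ne) ENNReal.ofReal_lt_top
  refine lt_of_le_of_lt ((setLIntegral_mono' measurableSet_Ioi fun x hx => ?_).trans
    (setLIntegral_le_lintegral _ _)) h1
  by_cases h : x < δ
  · simp [hδ' x hx h, hq0]
  · refine mul_le_mul' le_rfl (ENNReal.ofReal_le_ofReal ?_)
    exact Real.rpow_le_rpow_of_nonpos hδ (not_lt.1 h) (by nlinarith)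

/-- Fractional Hardy inequality on the half-line for test functions, valid on both sides of the
critical exponent `τq = 1`. A dilation by `λ` multiplies the Hardy norm by `λ^(τ - 1/q)`, which is
less than one for all `λ` in an interval to the right or to the left of `1`; so the Hardy norm is
controlled by that of `ψ(x) - ψ(λx)`, and averaging over `λ` gives the Gagliardo energy. -/
theorem hardyIntegral_le {τ q : ℝ} (hτ : 0 < τ) (hq : 1 ≤ q) (hτq : τ * q ≠ 1) :
    ∃ C : ℝ≥0∞, C < ⊤ ∧ ∀ ψ : ℝ → ℝ, IsTest (Ioi 0) ψ →
      hardyIntegral τ q ψ ≤ C * kernelEnergy (powKernel (1 + τ * q)) q (Ioi 0) ψ := by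
  have hq0 : 0 < q := by linarith
  have hτq0 : 0 < τ * q := by positivity
  have hqi : 0 ≤ 1 / q := by positivity
  set κ := τ - 1 / q with hκ
  obtain ⟨l, r, θ, hl, hlr, hθ0, hθ1, hJ⟩ : ∃ l r θ : ℝ, 0 < l ∧ l < r ∧ 0 ≤ θ ∧ θ < 1 ∧
      ∀ x ∈ Icc l r, x ^ κ ≤ θ ∧ |1 - x| ≤ 2 := by
    have hκ0 : κ ≠ 0 := by
      intro h
      apply hτq
      rw [hκ, sub_eq_zero] at h
      rw [h, one_div_mul_cancel hq0.ne']
    rcases hκ0.lt_or_gt with h | h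
    · refine ⟨2, 3, 2 ^ κ, by norm_num, by norm_num, by positivity,
        Real.rpow_lt_one_of_one_lt_of_neg (by norm_num) h, fun x hx => ⟨?_, ?_⟩⟩
      · exact Real.rpow_le_rpow_of_nonpos (by norm_num) hx.1 h.le
      · rw [abs_le]; constructor <;> linarith [hx.1, hx.2]
    · refine ⟨1 / 3, 1 / 2, (1 / 2) ^ κ, by norm_num, by norm_num, by positivity,
        Real.rpow_lt_one (by norm_num) (by norm_num) h, fun x hx => ⟨?_, ?_⟩⟩
      · exact Real.rpow_le_rpow (by linarith [hx.1]) hx.2 h.le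
      · rw [abs_le]; constructor <;> linarith [hx.1, hx.2]
  set c : ℝ≥0∞ := (1 - ENNReal.ofReal θ) ^ q * ENNReal.ofReal (r - l) with hc
  have hc0 : c ≠ 0 := by
    refine mul_ne_zero ?_ (by simpa using hlr)
    rw [Ne, ENNReal.rpow_eq_zero_iff_of_pos hq0, tsub_eq_zero_iff_le, not_le]
    simpa using hθ1
  have hct : c ≠ ⊤ := ENNReal.mul_ne_top (ENNReal.rpow_ne_top_of_nonneg hq0.le
    (ne_top_of_le_ne_top ENNReal.one_ne_top tsub_le_self)) ENNReal.ofReal_ne_top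
  set M : ℝ≥0∞ := ENNReal.ofReal (2 ^ (1 + τ * q)) with hM
  refine ⟨c⁻¹ * M, ENNReal.mul_lt_top (ENNReal.inv_lt_top.2 (pos_iff_ne_zero.2 hc0))
    ENNReal.ofReal_lt_top, fun ψ hψ => ?_⟩
  have hψm : Measurable ψ := hψ.smooth.continuous.measurable
  rw [mul_assoc, ← ENNReal.mul_le_iff_le_inv hc0 hct]
  set I := hardyIntegral τ q ψ with hI
  have hIt : I < ⊤ := hardyIntegral_lt_top hτ hq hψ
  set w : ℝ → ℝ≥0∞ := fun x => ENNReal.ofReal (x ^ (-(τ * q))) with hw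
  have hwm : Measurable w := by fun_prop
  set D : ℝ → ℝ≥0∞ := fun a => ∫⁻ x in Ioi 0, ‖ψ x - ψ (a * x)‖ₑ ^ q * w x
  have hwq : ∀ x, 0 < x → ENNReal.ofReal (x ^ (-τ)) ^ q = w x := by
    intro x hx
    rw [ENNReal.ofReal_rpow_of_pos (by positivity), ← Real.rpow_mul hx.le, neg_mul]
  -- the effect of a dilation
  have hscale : ∀ a : ℝ, 0 < a →
      ∫⁻ x in Ioi 0, ‖ψ (a * x)‖ₑ ^ q * w x = ENNReal.ofReal (a ^ (τ * q - 1)) * I := by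
    intro a ha
    have h1 := lintegral_comp_mul_left_pos ha
      (F := (Ioi (0 : ℝ)).indicator fun x => ‖ψ x‖ₑ ^ q * w x)
      (Measurable.indicator (by fun_prop) measurableSet_Ioi)
    rw [lintegral_indicator measurableSet_Ioi] at h1
    rw [hI, hardyIntegral, sub_eq_add_neg, Real.rpow_add ha, ENNReal.ofReal_mul (by positivity),
      Real.rpow_neg_one, mul_assoc, ← h1, ← lintegral_const_mul' _ _ ENNReal.ofReal_ne_top,
      ← lintegral_indicator measurableSet_Ioi]
    refine lintegral_congr fun x => ?_
    by_cases hx : 0 < x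
    · have hax : 0 < a * x := by positivity
      simp only [indicator, mem_Ioi, hx, hax, if_true, hw]
      rw [mul_left_comm, ← ENNReal.ofReal_mul (by positivity)]
      congr 2
      rw [Real.mul_rpow ha.le hx.le, ← mul_assoc, ← Real.rpow_add ha, add_neg_cancel,
        Real.rpow_zero, one_mul]
    · have hax : ¬ 0 < a * x := by simpa [ha] using hx
      simp [indicator, hx, hax]
  have hD_lower : ∀ a ∈ Icc l r, (1 - ENNReal.ofReal θ) ^ q * I ≤ D a := by
    intro a ha
    have ha0 : 0 < a := hl.trans_le ha.1
    have hmink := ENNReal.lintegral_Lp_add_le (μ := volume.restrict (Ioi (0 : ℝ))) (p := q)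
      (f := fun x => ‖ψ x - ψ (a * x)‖ₑ * ENNReal.ofReal (x ^ (-τ)))
      (g := fun x => ‖ψ (a * x)‖ₑ * ENNReal.ofReal (x ^ (-τ))) (by fun_prop) (by fun_prop) hq
    have e1 : I ≤ ∫⁻ x in Ioi 0, ((fun x => ‖ψ x - ψ (a * x)‖ₑ * ENNReal.ofReal (x ^ (-τ))) +
        fun x => ‖ψ (a * x)‖ₑ * ENNReal.ofReal (x ^ (-τ))) x ^ q := by
      refine setLIntegral_mono' measurableSet_Ioi fun x hx => ?_
      simp only [Pi.add_apply]
      rw [← add_mul, ENNReal.mul_rpow_of_nonneg _ _ hq0.le, hwq x hx]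
      gcongr
      simpa using enorm_add_le (ψ x - ψ (a * x)) (ψ (a * x))
    have e2 : ∫⁻ x in Ioi 0, (‖ψ x - ψ (a * x)‖ₑ * ENNReal.ofReal (x ^ (-τ))) ^ q = D a := by
      refine setLIntegral_congr_fun measurableSet_Ioi fun x hx => ?_
      rw [ENNReal.mul_rpow_of_nonneg _ _ hq0.le, hwq x hx]
    have e3 : ∫⁻ x in Ioi 0, (‖ψ (a * x)‖ₑ * ENNReal.ofReal (x ^ (-τ))) ^ q =
        ENNReal.ofReal (a ^ (τ * q - 1)) * I := by
      rw [← hscale a ha0]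
      refine setLIntegral_congr_fun measurableSet_Ioi fun x hx => ?_
      rw [ENNReal.mul_rpow_of_nonneg _ _ hq0.le, hwq x hx]
    rw [e2, e3] at hmink
    have e4 : (ENNReal.ofReal (a ^ (τ * q - 1)) * I) ^ (1 / q) ≤ ENNReal.ofReal θ * I ^ (1 / q) := by
      rw [ENNReal.mul_rpow_of_nonneg _ _ hqi, ENNReal.ofReal_rpow_of_pos (by positivity),
        ← Real.rpow_mul ha0.le]
      have : (τ * q - 1) * (1 / q) = κ := by rw [hκ]; field_simp
      rw [this]
      gcongr
      exact (hJ a ha).1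
    have e5 : I ^ (1 / q) ≤ D a ^ (1 / q) + ENNReal.ofReal θ * I ^ (1 / q) :=
      (ENNReal.rpow_le_rpow e1 hqi).trans (hmink.trans (by gcongr))
    have e6 : (1 - ENNReal.ofReal θ) * I ^ (1 / q) ≤ D a ^ (1 / q) := by
      rw [ENNReal.sub_mul (fun _ _ => ENNReal.rpow_ne_top_of_nonneg hqi hIt.ne), one_mul]
      exact tsub_le_iff_right.2 e5
    have e7 := ENNReal.rpow_le_rpow e6 hq0.le
    rwa [ENNReal.mul_rpow_of_nonneg _ _ hq0.le, ← ENNReal.rpow_mul, ← ENNReal.rpow_mul,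
      one_div_mul_cancel hq0.ne', ENNReal.rpow_one, ENNReal.rpow_one] at e7
  -- average over the dilations in `[l, r]`
  set g : ℝ → ℝ → ℝ≥0∞ := fun x y => (Ioi (0 : ℝ)).indicator
    (fun y => ‖ψ x - ψ y‖ₑ ^ q * powKernel (1 + τ * q) (x - y)) y with hg
  have hkm := measurable_powKernel (V := ℝ) (1 + τ * q)
  have hgm : ∀ x, Measurable (g x) := fun x => Measurable.indicator (by fun_prop) measurableSet_Ioi
  have hpt : ∀ a ∈ Icc l r, ∀ x ∈ Ioi (0 : ℝ), ‖ψ x - ψ (a * x)‖ₑ ^ q * w x ≤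
      M * (ENNReal.ofReal x * g x (x * a)) := by
    intro a ha x hx
    have hx : 0 < x := hx
    have ha0 : 0 < a := hl.trans_le ha.1
    have hxa : 0 < x * a := by positivity
    by_cases ha1 : a = 1
    · simp [ha1, hq0]
    have hne : 0 < |1 - a| := abs_pos.2 (sub_ne_zero.2 (Ne.symm ha1))
    simp only [hg, indicator, mem_Ioi, hxa, if_true]
    rw [mul_comm a x, mul_left_comm (ENNReal.ofReal x), mul_left_comm M]
    refine mul_le_mul' le_rfl ?_
    rw [hM, hw, powKernel, ← ENNReal.ofReal_mul (by positivity), ← ENNReal.ofReal_mul (by positivity)]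
    refine ENNReal.ofReal_le_ofReal ?_
    have e : ‖x - x * a‖ = x * |1 - a| := by
      rw [Real.norm_eq_abs, show x - x * a = x * (1 - a) by ring, abs_mul, abs_of_pos hx]
    have e2 : x * x ^ (-(1 + τ * q)) = x ^ (-(τ * q)) := by
      conv_lhs => rw [← Real.rpow_one x, ← Real.rpow_mul hx.le, one_mul]
      rw [← Real.rpow_add hx]; congr 1; ring
    rw [e, Real.mul_rpow hx.le hne.le, show (2 : ℝ) ^ (1 + τ * q) * (x * (x ^ (-(1 + τ * q)) *
      |1 - a| ^ (-(1 + τ * q)))) = x ^ (-(τ * q)) * (2 ^ (1 + τ * q) * |1 - a| ^ (-(1 + τ * q))) by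
        rw [← e2]; ring]
    refine le_mul_of_one_le_right (by positivity) ?_
    have h2 : (2 : ℝ) ^ (-(1 + τ * q)) ≤ |1 - a| ^ (-(1 + τ * q)) :=
      Real.rpow_le_rpow_of_nonpos hne (hJ a ha).2 (by linarith)
    calc (1 : ℝ) = 2 ^ (1 + τ * q) * 2 ^ (-(1 + τ * q)) := by
          rw [← Real.rpow_add (by norm_num), add_neg_cancel, Real.rpow_zero]
      _ ≤ _ := by gcongr
  calc c * I = ∫⁻ a in Icc l r, (1 - ENNReal.ofReal θ) ^ q * I := by
        rw [lintegral_const, Measure.restrict_apply_univ, Real.volume_Icc, hc]; ring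
    _ ≤ ∫⁻ a in Icc l r, D a := setLIntegral_mono' measurableSet_Icc hD_lower
    _ ≤ ∫⁻ a in Icc l r, ∫⁻ x in Ioi 0, M * (ENNReal.ofReal x * g x (x * a)) :=
        setLIntegral_mono' measurableSet_Icc fun a ha =>
          setLIntegral_mono' measurableSet_Ioi (hpt a ha)
    _ = ∫⁻ x in Ioi 0, ∫⁻ a in Icc l r, M * (ENNReal.ofReal x * g x (x * a)) := by
        refine lintegral_lintegral_swap (Measurable.aemeasurable ?_)
        refine measurable_const.mul (Measurable.mul (by fun_prop) ?_)
        have : (Function.uncurry fun a x : ℝ => g x (x * a)) =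
            {z : ℝ × ℝ | 0 < z.2 * z.1}.indicator (fun z => ‖ψ z.2 - ψ (z.2 * z.1)‖ₑ ^ q *
              powKernel (1 + τ * q) (z.2 - z.2 * z.1)) := by
          ext z; simp [Function.uncurry, hg, indicator]
        change Measurable (Function.uncurry fun a x : ℝ => g x (x * a))
        rw [this]
        exact Measurable.indicator (by fun_prop) (measurableSet_lt (by fun_prop) (by fun_prop))
    _ ≤ ∫⁻ x in Ioi 0, M * ∫⁻ y, g x y := by
        refine setLIntegral_mono' measurableSet_Ioi fun x hx => ?_
        have hx : 0 < x := hx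
        rw [lintegral_const_mul' _ _ ENNReal.ofReal_ne_top,
          lintegral_const_mul' _ _ ENNReal.ofReal_ne_top]
        refine mul_le_mul' le_rfl ((mul_le_mul' le_rfl (setLIntegral_le_lintegral _ _)).trans ?_)
        rw [lintegral_comp_mul_left_pos hx (hgm x), ← mul_assoc, ← ENNReal.ofReal_mul hx.le,
          mul_inv_cancel₀ hx.ne', ENNReal.ofReal_one, one_mul]
    _ = M * kernelEnergy (powKernel (1 + τ * q)) q (Ioi 0) ψ := by
        rw [lintegral_const_mul' _ _ ENNReal.ofReal_ne_top, kernelEnergy,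
          lintegral_prod _ (by fun_prop)]
        simp only [hg, lintegral_indicator measurableSet_Ioi]
        rfl

/-- Extension by zero: away from the critical exponent, the seminorm on the line of a function
supported in the half-line is controlled by its seminorm on the half-line. -/
theorem sobolevSeminorm_univ_le_Ioi {τ q : ℝ} (hτ : 0 < τ) (hq : 1 ≤ q) (hτq : τ * q ≠ 1) :
    ∃ C : ℝ≥0∞, C < ⊤ ∧ ∀ ψ : ℝ → ℝ, IsTest (Ioi 0) ψ →
      sobolevSeminorm τ q univ ψ ≤ C * sobolevSeminorm τ q (Ioi 0) ψ := by
  have hq0 : 0 < q := by linarith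
  have hτq0 : 0 < τ * q := by positivity
  obtain ⟨C, hC, hhardy⟩ := hardyIntegral_le hτ hq hτq
  set B := ∫⁻ z : ℝ, ENNReal.ofReal ((1 + ‖z‖ ^ 2) ^ (-(1 + τ * q) / 2))
  have hBt : B < ⊤ := lintegral_one_add_sq_rpow_lt_top (by simp [hτq0])
  have hK : 1 + (B * C + B * C) < ⊤ :=
    ENNReal.add_lt_top.2 ⟨ENNReal.one_lt_top, ENNReal.add_lt_top.2
      ⟨ENNReal.mul_lt_top hBt hC, ENNReal.mul_lt_top hBt hC⟩⟩
  refine ⟨(1 + (B * C + B * C)) ^ (1 / q),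
    ENNReal.rpow_lt_top_of_nonneg (by positivity) hK.ne, fun ψ hψ => ?_⟩
  have hψm : Measurable ψ := hψ.smooth.continuous.measurable
  rw [sobolevSeminorm_eq hq0, sobolevSeminorm_eq hq0,
    ← ENNReal.mul_rpow_of_nonneg _ _ (by positivity)]
  refine ENNReal.rpow_le_rpow ?_ (by positivity)
  rw [Module.finrank_self, Nat.cast_one]
  have hkm := measurable_powKernel (V := ℝ) (1 + τ * q)
  set F : ℝ × ℝ → ℝ≥0∞ := fun z => ‖ψ z.1 - ψ z.2‖ₑ ^ q * powKernel (1 + τ * q) (z.1 - z.2) with hF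
  have hFm : Measurable F := by fun_prop
  set T : ℝ → ℝ → ℝ≥0∞ := fun x y => (Ioi (0 : ℝ)).indicator
    (fun x => ‖ψ x‖ₑ ^ q * ENNReal.ofReal ((‖y‖ ^ 2 + x ^ 2) ^ (-(1 + τ * q) / 2))) x with hT
  have hTm : Measurable fun z : ℝ × ℝ => T z.1 z.2 := by
    have : (fun z : ℝ × ℝ => T z.1 z.2) = {z : ℝ × ℝ | 0 < z.1}.indicator
        fun z => ‖ψ z.1‖ₑ ^ q * ENNReal.ofReal ((‖z.2‖ ^ 2 + z.1 ^ 2) ^ (-(1 + τ * q) / 2)) := by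
      ext z; simp [hT, indicator]
    rw [this]
    exact Measurable.indicator (by fun_prop) (measurableSet_lt (by fun_prop) (by fun_prop))
  have hTint : ∫⁻ x, ∫⁻ y, T x y ≤ B * C * kernelEnergy (powKernel (1 + τ * q)) q (Ioi 0) ψ := by
    have : ∀ x, ∫⁻ y, T x y = (Ioi (0 : ℝ)).indicator
        (fun x => B * (‖ψ x‖ₑ ^ q * ENNReal.ofReal (x ^ (-(τ * q))))) x := by
      intro x
      by_cases hx : 0 < x
      · simp only [hT, indicator, mem_Ioi, hx, if_true]
        rw [lintegral_const_mul _ (by fun_prop), lintegral_add_sq_rpow _ hx, Module.finrank_self,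
          Nat.cast_one, show (1 : ℝ) - (1 + τ * q) = -(τ * q) by ring]
        ring
      · simp [hT, indicator, hx]
    simp_rw [this]
    rw [lintegral_indicator measurableSet_Ioi, lintegral_const_mul' _ _ hBt.ne, mul_assoc]
    gcongr
    exact hhardy ψ hψ
  have hcross : ∀ x y : ℝ, 0 < x → y ≤ 0 → ‖ψ x‖ₑ ^ q * powKernel (1 + τ * q) (x - y) ≤ T x y := by
    intro x y hx hy
    simp only [hT, indicator, mem_Ioi, hx, if_true, powKernel]
    refine mul_le_mul' le_rfl (ENNReal.ofReal_le_ofReal ?_)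
    have : ‖x - y‖ ^ (-(1 + τ * q)) = (‖x - y‖ ^ 2) ^ (-(1 + τ * q) / 2) := by
      rw [← Real.rpow_natCast, ← Real.rpow_mul (norm_nonneg _)]; congr 1; push_cast; ring
    rw [this]
    refine Real.rpow_le_rpow_of_nonpos (by positivity) ?_ (by linarith)
    simp only [Real.norm_eq_abs, sq_abs]
    nlinarith
  have hsplit : ∀ z : ℝ × ℝ, F z ≤
      (Ioi (0 : ℝ) ×ˢ Ioi (0 : ℝ)).indicator F z + (T z.1 z.2 + T z.2 z.1) := by
    rintro ⟨x, y⟩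
    by_cases hx : 0 < x <;> by_cases hy : 0 < y
    · simp [indicator, hx, hy]
    · have : ψ y = 0 := hψ.eq_zero_of_notMem hy
      refine le_add_left (le_add_right ?_)
      simpa [hF, this] using hcross x y hx (not_lt.1 hy)
    · have : ψ x = 0 := hψ.eq_zero_of_notMem hx
      refine le_add_left (le_add_left ?_)
      have h := hcross y x hy (not_lt.1 hx)
      simpa [hF, this, powKernel, abs_sub_comm] using h
    · simp [hF, hψ.eq_zero_of_notMem hx, hψ.eq_zero_of_notMem hy, hq0]
  calc kernelEnergy (powKernel (1 + τ * q)) q univ ψ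
      ≤ ∫⁻ z : ℝ × ℝ, (Ioi (0 : ℝ) ×ˢ Ioi (0 : ℝ)).indicator F z + (T z.1 z.2 + T z.2 z.1)
          ∂(volume.prod volume) := by
        rw [kernelEnergy, Measure.restrict_univ]
        exact lintegral_mono hsplit
    _ = kernelEnergy (powKernel (1 + τ * q)) q (Ioi 0) ψ +
          ((∫⁻ x, ∫⁻ y, T x y) + ∫⁻ x, ∫⁻ y, T x y) := by
        have hTm' : Measurable fun z : ℝ × ℝ => T z.2 z.1 := hTm.comp measurable_swap
        rw [lintegral_add_left (hFm.indicator (measurableSet_Ioi.prod measurableSet_Ioi)),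
          lintegral_add_left hTm, lintegral_indicator (measurableSet_Ioi.prod measurableSet_Ioi),
          ← Measure.prod_restrict, lintegral_prod _ hTm.aemeasurable,
          lintegral_prod_symm _ hTm'.aemeasurable, kernelEnergy]
    _ ≤ _ := by
        rw [add_mul, one_mul, add_mul]
        gcongr

end HalfLine

/-! ### Coordinates on pairs of points of a slab -/

section Coordinates

variable {d : ℕ}

@[simp] theorem Space.fst_mk (x : EuclideanSpace ℝ (Fin d)) (r : ℝ) : (Space.mk x r).fst = x := rfl

@[simp] theorem Space.snd_mk (x : EuclideanSpace ℝ (Fin d)) (r : ℝ) : (Space.mk x r).snd = r := rfl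

theorem Space.mk_sub_mk (x y : EuclideanSpace ℝ (Fin d)) (a b : ℝ) :
    Space.mk x a - Space.mk y b = Space.mk (x - y) (a - b) := rfl

theorem Space.norm_mk_sq (x : EuclideanSpace ℝ (Fin d)) (a : ℝ) :
    ‖Space.mk x a‖ ^ 2 = ‖x‖ ^ 2 + a ^ 2 := by
  rw [WithLp.prod_norm_sq_eq_of_L2, Space.fst_mk, Space.snd_mk, Real.norm_eq_abs, sq_abs]

theorem Space.finrank_eq : (Module.finrank ℝ (Space d) : ℝ) = d + 1 := by
  have : Module.finrank ℝ (Space d) = d + 1 := by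
    rw [LinearEquiv.finrank_eq (WithLp.linearEquiv 2 ℝ (EuclideanSpace ℝ (Fin d) × ℝ))]
    simp
  rw [this]; push_cast; rfl

theorem Space.norm_mk_sub_rpow (x y : EuclideanSpace ℝ (Fin d)) (a b e : ℝ) :
    ‖Space.mk x a - Space.mk y b‖ ^ e = (‖x - y‖ ^ 2 + (a - b) ^ 2) ^ (e / 2) := by
  rw [Space.mk_sub_mk, ← Space.norm_mk_sq, ← Real.rpow_natCast, ← Real.rpow_mul (norm_nonneg _)]
  congr 1; push_cast; ring

theorem Space.continuous_mk :
    Continuous fun w : EuclideanSpace ℝ (Fin d) × ℝ => Space.mk w.1 w.2 :=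
  WithLp.prod_continuous_toLp 2 _ _

@[fun_prop] theorem Measurable.spaceMk {X : Type*} [MeasurableSpace X]
    {f : X → EuclideanSpace ℝ (Fin d)} {g : X → ℝ} (hf : Measurable f) (hg : Measurable g) :
    Measurable fun x => Space.mk (f x) (g x) :=
  Space.continuous_mk.measurable.comp (hf.prodMk hg)

@[fun_prop] theorem Space.measurable_fst : Measurable fun x : Space d => x.fst :=
  (WithLp.prod_continuous_ofLp 2 _ _).fst.measurable

@[fun_prop] theorem Space.measurable_snd : Measurable fun x : Space d => x.snd :=
  (WithLp.prod_continuous_ofLp 2 _ _).snd.measurable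

/-- The set `ℝᵈ × I`; the half-space is the case `I = (0, ∞)`. -/
def slab (d : ℕ) (I : Set ℝ) : Set (Space d) := {x | x.snd ∈ I}

theorem slab_Ioi : slab d (Ioi 0) = upperHalf d := rfl

theorem slab_univ : slab d univ = univ := by ext; simp [slab]

theorem measurableSet_slab {I : Set ℝ} (hI : MeasurableSet I) : MeasurableSet (slab d I) :=
  Space.measurable_snd hI

theorem measurePreserving_mk (I : Set ℝ) (hI : MeasurableSet I) :
    MeasurePreserving (fun w : EuclideanSpace ℝ (Fin d) × ℝ => Space.mk w.1 w.2)
      ((volume : Measure (EuclideanSpace ℝ (Fin d))).prod (volume.restrict I))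
      (volume.restrict (slab d I)) := by
  have h : MeasurePreserving (WithLp.toLp 2 : EuclideanSpace ℝ (Fin d) × ℝ → Space d) volume volume :=
    WithLp.volume_preserving_toLp (EuclideanSpace ℝ (Fin d)) ℝ
  have h2 := h.restrict_preimage (measurableSet_slab hI)
  have e : (volume : Measure (EuclideanSpace ℝ (Fin d) × ℝ)).restrict
      (WithLp.toLp 2 ⁻¹' slab d I) =
      (volume : Measure (EuclideanSpace ℝ (Fin d))).prod (volume.restrict I) := by
    have : (WithLp.toLp 2 ⁻¹' slab d I : Set (EuclideanSpace ℝ (Fin d) × ℝ)) = univ ×ˢ I := by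
      ext w; simp [slab]
    rw [this, Measure.volume_eq_prod, ← Measure.prod_restrict, Measure.restrict_univ]
  rw [e] at h2
  exact h2

theorem lintegral_slab {I : Set ℝ} (hI : MeasurableSet I) {F : Space d → ℝ≥0∞} (hF : Measurable F) :
    ∫⁻ P in slab d I, F P = ∫⁻ x : EuclideanSpace ℝ (Fin d), ∫⁻ a in I, F (Space.mk x a) := by
  rw [← (measurePreserving_mk I hI).lintegral_comp hF, lintegral_prod _ (by fun_prop)]

/-- Rearrangement `(α × β) × (γ × δ) ≃ (α × γ) × (β × δ)` of the factors of a product. -/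
def middleSwap (α β γ δ : Type*) [MeasurableSpace α] [MeasurableSpace β] [MeasurableSpace γ]
    [MeasurableSpace δ] : (α × β) × γ × δ ≃ᵐ (α × γ) × β × δ where
  toEquiv := Equiv.prodProdProdComm α β γ δ
  measurable_toFun := by
    change Measurable fun w : (α × β) × γ × δ => ((w.1.1, w.2.1), (w.1.2, w.2.2))
    fun_prop
  measurable_invFun := by
    change Measurable fun w : (α × γ) × β × δ => ((w.1.1, w.2.1), (w.1.2, w.2.2))
    fun_prop

theorem measurePreserving_middleSwap {α β γ δ : Type*} [MeasurableSpace α] [MeasurableSpace β]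
    [MeasurableSpace γ] [MeasurableSpace δ] (μa : Measure α) (μb : Measure β) (μc : Measure γ)
    (μd : Measure δ) [SFinite μa] [SFinite μb] [SFinite μc] [SFinite μd] :
    MeasurePreserving (middleSwap α β γ δ) ((μa.prod μb).prod (μc.prod μd))
      ((μa.prod μc).prod (μb.prod μd)) := by
  have h1 := measurePreserving_prodAssoc μa μb (μc.prod μd)
  have h2 := (MeasurePreserving.id μa).prod ((measurePreserving_prodAssoc μb μc μd).symm)
  have h3 := (MeasurePreserving.id μa).prod
    ((Measure.measurePreserving_swap (μ := μb) (ν := μc)).prod (MeasurePreserving.id μd))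
  have h4 := (MeasurePreserving.id μa).prod (measurePreserving_prodAssoc μc μb μd)
  have h5 := (measurePreserving_prodAssoc μa μc (μb.prod μd)).symm
  exact h5.comp (h4.comp (h3.comp (h2.comp h1)))

/-- Coordinates on pairs of points of a slab: tangential variables first, then normal variables. -/
noncomputable def pairCoord (d : ℕ) :
    (EuclideanSpace ℝ (Fin d) × EuclideanSpace ℝ (Fin d)) × ℝ × ℝ ≃ᵐ Space d × Space d :=
  (middleSwap _ _ _ _).trans ((MeasurableEquiv.toLp 2 _).prodCongr (MeasurableEquiv.toLp 2 _))

theorem pairCoord_apply (w : (EuclideanSpace ℝ (Fin d) × EuclideanSpace ℝ (Fin d)) × ℝ × ℝ) :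
    pairCoord d w = (Space.mk w.1.1 w.2.1, Space.mk w.1.2 w.2.2) := rfl

/-- Lebesgue measure on pairs of points of a slab, in the coordinates `pairCoord`. -/
noncomputable def pairMeasure (d : ℕ) (I : Set ℝ) :
    Measure ((EuclideanSpace ℝ (Fin d) × EuclideanSpace ℝ (Fin d)) × ℝ × ℝ) :=
  (volume.prod volume).prod ((volume.restrict I).prod (volume.restrict I))

theorem measurePreserving_pairCoord {I : Set ℝ} (hI : MeasurableSet I) :
    MeasurePreserving (pairCoord d) (pairMeasure d I)
      ((volume.restrict (slab d I)).prod (volume.restrict (slab d I))) := by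
  have h := (measurePreserving_mk (d := d) I hI).prod (measurePreserving_mk (d := d) I hI)
  exact h.comp (measurePreserving_middleSwap _ _ _ _)

theorem integral_pairCoord {I : Set ℝ} (hI : MeasurableSet I) (F : Space d × Space d → ℝ) :
    ∫ z, F z ∂((volume.restrict (slab d I)).prod (volume.restrict (slab d I))) =
      ∫ w, F (pairCoord d w) ∂(pairMeasure d I) :=
  ((measurePreserving_pairCoord hI).integral_comp (pairCoord d).measurableEmbedding F).symm

theorem lintegral_pairCoord {I : Set ℝ} (hI : MeasurableSet I) (F : Space d × Space d → ℝ≥0∞) :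
    ∫⁻ z, F z ∂((volume.restrict (slab d I)).prod (volume.restrict (slab d I))) =
      ∫⁻ w, F (pairCoord d w) ∂(pairMeasure d I) :=
  ((measurePreserving_pairCoord hI).lintegral_comp_emb (pairCoord d).measurableEmbedding F).symm

end Coordinates

/-! ### Slicing in the normal direction -/

section Slicing

variable {d : ℕ}

/-- The normal part `∫ ∫_I ∫_I |U(x', a) - U(x', b)|² / |a - b|^(1 + 2s) da db dx'` of the Gagliardo
energy of a function on the slab `ℝᵈ × I`. -/
noncomputable def normalEnergy (s : ℝ) (I : Set ℝ) (U : Space d → ℝ) : ℝ≥0∞ :=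
  ∫⁻ x : EuclideanSpace ℝ (Fin d), ∫⁻ a in I, ∫⁻ b in I,
    ‖U (Space.mk x a) - U (Space.mk x b)‖ₑ ^ (2 : ℝ) * powKernel (1 + 2 * s) (a - b)

theorem enorm_sub_sq_le (a b c : ℝ) :
    ‖a - b‖ₑ ^ (2 : ℝ) ≤ 2 * (‖a - c‖ₑ ^ (2 : ℝ) + ‖b - c‖ₑ ^ (2 : ℝ)) := by
  have h : ‖a - b‖ₑ ≤ ‖a - c‖ₑ + ‖b - c‖ₑ := by
    have := enorm_sub_le (a := a - c) (b := b - c)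
    simpa using this
  refine (ENNReal.rpow_le_rpow h (by norm_num)).trans
    ((ENNReal.rpow_add_le_mul_rpow_add_rpow _ _ (by norm_num)).trans_eq ?_)
  norm_num

/-- The ball having the segment from `(x', a)` to `(x', b)` as a diameter lies in the slab, has
volume comparable to `|a - b|ⁿ`, and its points are within `|a - b|` of both end points. Averaging
`|U(x', a) - U(w)|² + |U(x', b) - U(w)|²` over it bounds the difference in the normal direction. -/
theorem normal_difference_le {s : ℝ} (hs : 0 < s) {I : Set ℝ} (hI : I.OrdConnected)
    {U : Space d → ℝ} (hU : Measurable U) (x : EuclideanSpace ℝ (Fin d))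
    {a b : ℝ} (ha : a ∈ I) (hb : b ∈ I) :
    volume (Metric.ball (0 : Space d) (1 / 2)) *
      (‖U (Space.mk x a) - U (Space.mk x b)‖ₑ ^ (2 : ℝ) * powKernel (1 + 2 * s) (a - b)) ≤
    2 * ENNReal.ofReal (2 ^ ((d + 2 + 2 * s) / 2)) *
      ((∫⁻ w in slab d I, ‖U (Space.mk x a) - U w‖ₑ ^ (2 : ℝ) *
        ENNReal.ofReal ((‖a - b‖ ^ 2 + ‖Space.mk x a - w‖ ^ 2) ^ (-(d + 2 + 2 * s) / 2))) +
       ∫⁻ w in slab d I, ‖U (Space.mk x b) - U w‖ₑ ^ (2 : ℝ) *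
        ENNReal.ofReal ((‖b - a‖ ^ 2 + ‖Space.mk x b - w‖ ^ 2) ^ (-(d + 2 + 2 * s) / 2))) := by
  rcases eq_or_ne a b with rfl | hab
  · simp
  set h : ℝ := ‖a - b‖ with hh
  have hh' : ‖b - a‖ = h := by rw [hh, norm_sub_rev]
  have hpos : 0 < h := norm_pos_iff.2 (sub_ne_zero.2 hab)
  set α : ℝ := d + 2 + 2 * s with hα
  have hα0 : 0 < α := by positivity
  set S := Metric.ball (Space.mk x ((a + b) / 2)) (h / 2) with hS
  have hSI : S ⊆ slab d I := by
    intro w hw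
    have h1 : |w.snd - (a + b) / 2| < h / 2 := by
      have h2 : ‖w - Space.mk x ((a + b) / 2)‖ < h / 2 := by simpa [hS, dist_eq_norm] using hw
      refine lt_of_le_of_lt ?_ h2
      refine abs_le_of_sq_le_sq ?_ (norm_nonneg _)
      rw [WithLp.prod_norm_sq_eq_of_L2]
      have : (w - Space.mk x ((a + b) / 2)).snd = w.snd - (a + b) / 2 := rfl
      rw [this, Real.norm_eq_abs, sq_abs]
      linarith [sq_nonneg ‖(w - Space.mk x ((a + b) / 2)).fst‖]
    rw [abs_lt] at h1
    rw [hh, Real.norm_eq_abs] at h1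
    change w.snd ∈ I
    rcases le_total a b with hle | hle
    · rw [abs_of_nonpos (by linarith)] at h1
      exact hI.out ha hb ⟨by linarith, by linarith⟩
    · rw [abs_of_nonneg (by linarith)] at h1
      exact hI.out hb ha ⟨by linarith, by linarith⟩
  have hvol : volume S = ENNReal.ofReal (h ^ ((d : ℝ) + 1)) *
      volume (Metric.ball (0 : Space d) (1 / 2)) := by
    rw [hS, Measure.addHaar_ball_center,
      show h / 2 = h * (1 / 2) by ring, Measure.addHaar_ball_mul _ _ hpos.le,
      ← Real.rpow_natCast, Space.finrank_eq]
  have hnear : ∀ c : ℝ, |c - (a + b) / 2| = h / 2 → ∀ w ∈ S, ‖Space.mk x c - w‖ ≤ h := by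
    intro c hc w hw
    have h2 : ‖Space.mk x ((a + b) / 2) - w‖ < h / 2 := by
      rw [norm_sub_rev]; simpa [hS, dist_eq_norm] using hw
    have h3 : ‖Space.mk x c - Space.mk x ((a + b) / 2)‖ = h / 2 := by
      rw [Space.mk_sub_mk, sub_self, ← hc, ← abs_of_nonneg (norm_nonneg (Space.mk _ _)), ← sq_eq_sq_iff_abs_eq_abs,
        Space.norm_mk_sq]
      simp
    calc ‖Space.mk x c - w‖ = ‖(Space.mk x c - Space.mk x ((a + b) / 2)) +
          (Space.mk x ((a + b) / 2) - w)‖ := by congr 1; abel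
      _ ≤ _ := norm_add_le _ _
      _ ≤ h := by rw [h3]; linarith
  have hca : |a - (a + b) / 2| = h / 2 := by
    rw [show a - (a + b) / 2 = (a - b) / 2 by ring, abs_div, hh, Real.norm_eq_abs]; norm_num
  have hcb : |b - (a + b) / 2| = h / 2 := by
    rw [show b - (a + b) / 2 = (b - a) / 2 by ring, abs_div, ← hh', Real.norm_eq_abs]; norm_num
  have hker : ∀ δ : ℝ, 0 ≤ δ → δ ≤ h → h ^ (-α) ≤ 2 ^ (α / 2) * (h ^ 2 + δ ^ 2) ^ (-α / 2) := by
    intro δ hδ0 hδ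
    have e1 : h ^ (-α) = (h ^ 2) ^ (-α / 2) := by
      rw [← Real.rpow_natCast, ← Real.rpow_mul hpos.le]; congr 1; push_cast; ring
    have e2 : (2 : ℝ) ^ (α / 2) * (h ^ 2 + δ ^ 2) ^ (-α / 2) = ((h ^ 2 + δ ^ 2) / 2) ^ (-α / 2) := by
      rw [Real.div_rpow (by positivity) (by positivity), neg_div,
        Real.rpow_neg (by positivity) (x := 2)]
      field_simp
    rw [e1, e2]
    exact Real.rpow_le_rpow_of_nonpos (by positivity) (by nlinarith) (by linarith)
  set Q : ℝ → Space d → ℝ≥0∞ := fun c w =>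
    ENNReal.ofReal ((h ^ 2 + ‖Space.mk x c - w‖ ^ 2) ^ (-α / 2)) with hQ
  have hQm : ∀ c, Measurable (Q c) := fun c => by fun_prop
  have hpt : ∀ w ∈ S, ‖U (Space.mk x a) - U (Space.mk x b)‖ₑ ^ (2 : ℝ) * ENNReal.ofReal (h ^ (-α)) ≤
      2 * ENNReal.ofReal (2 ^ (α / 2)) * (‖U (Space.mk x a) - U w‖ₑ ^ (2 : ℝ) * Q a w +
        ‖U (Space.mk x b) - U w‖ₑ ^ (2 : ℝ) * Q b w) := by
    intro w hw
    have k1 : ∀ c, |c - (a + b) / 2| = h / 2 →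
        ENNReal.ofReal (h ^ (-α)) ≤ ENNReal.ofReal (2 ^ (α / 2)) * Q c w := by
      intro c hc
      rw [hQ, ← ENNReal.ofReal_mul (by positivity)]
      exact ENNReal.ofReal_le_ofReal (hker _ (norm_nonneg _) (hnear c hc w hw))
    calc _ ≤ 2 * (‖U (Space.mk x a) - U w‖ₑ ^ (2 : ℝ) + ‖U (Space.mk x b) - U w‖ₑ ^ (2 : ℝ)) *
          ENNReal.ofReal (h ^ (-α)) := by gcongr; exact enorm_sub_sq_le _ _ _
      _ = 2 * (‖U (Space.mk x a) - U w‖ₑ ^ (2 : ℝ) * ENNReal.ofReal (h ^ (-α)) +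
          ‖U (Space.mk x b) - U w‖ₑ ^ (2 : ℝ) * ENNReal.ofReal (h ^ (-α))) := by ring
      _ ≤ 2 * (‖U (Space.mk x a) - U w‖ₑ ^ (2 : ℝ) * (ENNReal.ofReal (2 ^ (α / 2)) * Q a w) +
          ‖U (Space.mk x b) - U w‖ₑ ^ (2 : ℝ) * (ENNReal.ofReal (2 ^ (α / 2)) * Q b w)) := by
        gcongr
        · exact k1 a hca
        · exact k1 b hcb
      _ = _ := by ring
  have hsplit : powKernel (1 + 2 * s) (a - b) =
      ENNReal.ofReal (h ^ ((d : ℝ) + 1)) * ENNReal.ofReal (h ^ (-α)) := by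
    rw [powKernel, ← ENNReal.ofReal_mul (by positivity), ← Real.rpow_add hpos, ← hh, hα]
    congr 2; ring
  rw [hh']
  calc _ = ∫⁻ w in S, ‖U (Space.mk x a) - U (Space.mk x b)‖ₑ ^ (2 : ℝ) * ENNReal.ofReal (h ^ (-α)) := by
        rw [lintegral_const, Measure.restrict_apply_univ, hvol, hsplit]; ring
    _ ≤ ∫⁻ w in S, 2 * ENNReal.ofReal (2 ^ (α / 2)) *
          (‖U (Space.mk x a) - U w‖ₑ ^ (2 : ℝ) * Q a w +
            ‖U (Space.mk x b) - U w‖ₑ ^ (2 : ℝ) * Q b w) :=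
        setLIntegral_mono' measurableSet_ball hpt
    _ ≤ ∫⁻ w in slab d I, 2 * ENNReal.ofReal (2 ^ (α / 2)) *
          (‖U (Space.mk x a) - U w‖ₑ ^ (2 : ℝ) * Q a w +
            ‖U (Space.mk x b) - U w‖ₑ ^ (2 : ℝ) * Q b w) := lintegral_mono_set hSI
    _ = _ := by
        rw [lintegral_const_mul _ (by fun_prop), lintegral_add_left (by fun_prop)]

/-- The integrand that arises when a difference in the normal direction is averaged over an
intermediate point `w`. -/
noncomputable def averagingTerm (s : ℝ) (U : Space d → ℝ) (x : EuclideanSpace ℝ (Fin d)) (a b : ℝ)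
    (w : Space d) : ℝ≥0∞ :=
  ‖U (Space.mk x a) - U w‖ₑ ^ (2 : ℝ) *
    ENNReal.ofReal ((‖a - b‖ ^ 2 + ‖Space.mk x a - w‖ ^ 2) ^ (-(d + 2 + 2 * s) / 2))

@[fun_prop] theorem Measurable.averagingTerm {X : Type*} [MeasurableSpace X] (s : ℝ)
    {U : Space d → ℝ} (hU : Measurable U) {x : X → EuclideanSpace ℝ (Fin d)} {a b : X → ℝ}
    {w : X → Space d} (hx : Measurable x) (ha : Measurable a) (hb : Measurable b)
    (hw : Measurable w) : Measurable fun z => averagingTerm s U (x z) (a z) (b z) (w z) := by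
  unfold _root_.averagingTerm
  fun_prop

/-- Integrating out the end point `b` turns the kernel of `averagingTerm` into the Gagliardo kernel. -/
theorem lintegral_averagingTerm_le {s : ℝ} (hs : 0 < s) :
    ∃ B : ℝ≥0∞, B < ⊤ ∧ ∀ (I : Set ℝ), MeasurableSet I → ∀ U : Space d → ℝ, Measurable U →
      ∫⁻ x, ∫⁻ a in I, ∫⁻ b in I, ∫⁻ w in slab d I, averagingTerm s U x a b w ≤
        B * kernelEnergy (powKernel (d + 1 + 2 * s)) 2 (slab d I) U := by
  set α : ℝ := d + 2 + 2 * s with hα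
  set B := ∫⁻ z : ℝ, ENNReal.ofReal ((1 + ‖z‖ ^ 2) ^ (-α / 2))
  have hBt : B < ⊤ := lintegral_one_add_sq_rpow_lt_top (by
    rw [Module.finrank_self, Nat.cast_one, hα]; have : (0 : ℝ) ≤ d := Nat.cast_nonneg _; linarith)
  refine ⟨B, hBt, fun I hIm U hU => ?_⟩
  have hk := measurable_powKernel (V := Space d) (d + 1 + 2 * s)
  have hg : Measurable fun z : Space d × Space d => ‖U z.1 - U z.2‖ₑ ^ (2 : ℝ) *
      powKernel (d + 1 + 2 * s) (z.1 - z.2) := by fun_prop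
  calc _ ≤ ∫⁻ x, ∫⁻ a in I, ∫⁻ w in slab d I, B * (‖U (Space.mk x a) - U w‖ₑ ^ (2 : ℝ) *
        powKernel (d + 1 + 2 * s) (Space.mk x a - w)) := by
        refine lintegral_mono fun x => lintegral_mono fun a => ?_
        dsimp only
        rw [lintegral_lintegral_swap (Measurable.aemeasurable
          (by rw [Function.uncurry_def]; fun_prop))]
        refine lintegral_mono fun w => ?_
        rcases (norm_nonneg (Space.mk x a - w)).eq_or_lt with h0 | h0
        · have : Space.mk x a = w := by rw [eq_comm, norm_eq_zero, sub_eq_zero] at h0; exact h0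
          simp [averagingTerm, this]
        · refine (setLIntegral_le_lintegral _ _).trans_eq ?_
          simp only [averagingTerm]
          rw [lintegral_const_mul _ (by fun_prop), mul_left_comm]
          congr 1
          rw [lintegral_sub_left_eq_self (fun b : ℝ => ENNReal.ofReal
            ((‖b‖ ^ 2 + ‖Space.mk x a - w‖ ^ 2) ^ (-α / 2))) a,
            lintegral_add_sq_rpow _ h0, Module.finrank_self, Nat.cast_one, powKernel, mul_comm, hα]
          congr 3; ring
    _ = _ := by
        rw [kernelEnergy, lintegral_prod _ hg.aemeasurable,
          lintegral_slab hIm hg.lintegral_prod_right', ← lintegral_const_mul' _ _ hBt.ne]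
        refine lintegral_congr fun x => ?_
        rw [← lintegral_const_mul' _ _ hBt.ne]
        refine lintegral_congr fun a => ?_
        rw [lintegral_const_mul' _ _ hBt.ne]

theorem measurable_lintegral_averagingTerm (s : ℝ) (I : Set ℝ) {U : Space d → ℝ}
    (hU : Measurable U) : Measurable fun z : EuclideanSpace ℝ (Fin d) × ℝ × ℝ =>
      ∫⁻ w in slab d I, averagingTerm s U z.1 z.2.1 z.2.2 w := by
  have : Measurable (Function.uncurry fun (z : EuclideanSpace ℝ (Fin d) × ℝ × ℝ) w =>
      averagingTerm s U z.1 z.2.1 z.2.2 w) := by rw [Function.uncurry_def]; fun_prop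
  exact this.lintegral_prod_right

/-- The normal part of the Gagliardo energy on a slab is controlled by the full energy. -/
theorem normalEnergy_le {s : ℝ} (hs : 0 < s) :
    ∃ C : ℝ≥0∞, C < ⊤ ∧ ∀ (I : Set ℝ), I.OrdConnected → MeasurableSet I →
      ∀ U : Space d → ℝ, Measurable U →
      normalEnergy s I U ≤ C * kernelEnergy (powKernel (d + 1 + 2 * s)) 2 (slab d I) U := by
  set m₀ := volume (Metric.ball (0 : Space d) (1 / 2))
  have hm₀0 : m₀ ≠ 0 := (Metric.measure_ball_pos _ _ (by norm_num)).ne'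
  have hm₀t : m₀ ≠ ⊤ := measure_ball_lt_top.ne
  obtain ⟨B, hBt, key⟩ := lintegral_averagingTerm_le (d := d) hs
  set M : ℝ≥0∞ := 2 * ENNReal.ofReal (2 ^ ((d + 2 + 2 * s) / 2))
  have hMt : M < ⊤ := ENNReal.mul_lt_top (by simp) ENNReal.ofReal_lt_top
  refine ⟨m₀⁻¹ * (M * (2 * B)), ENNReal.mul_lt_top (ENNReal.inv_lt_top.2 (pos_iff_ne_zero.2 hm₀0))
    (ENNReal.mul_lt_top hMt (ENNReal.mul_lt_top (by simp) hBt)), fun I hI hIm U hU => ?_⟩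
  rw [mul_assoc, ← ENNReal.mul_le_iff_le_inv hm₀0 hm₀t]
  have hmeas := measurable_lintegral_averagingTerm s I hU
  set T : EuclideanSpace ℝ (Fin d) → ℝ → ℝ → ℝ≥0∞ := fun x a b =>
    ∫⁻ w in slab d I, averagingTerm s U x a b w
  have hT3 : Measurable fun z : (EuclideanSpace ℝ (Fin d) × ℝ) × ℝ => T z.1.1 z.1.2 z.2 := by
    have h := hmeas.comp (by fun_prop : Measurable fun z : (EuclideanSpace ℝ (Fin d) × ℝ) × ℝ =>
      (z.1.1, z.1.2, z.2))
    exact h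
  have hT2 : Measurable fun z : EuclideanSpace ℝ (Fin d) × ℝ => ∫⁻ b in I, T z.1 z.2 b :=
    hT3.lintegral_prod_right'
  have hT1 : Measurable fun x => ∫⁻ a in I, ∫⁻ b in I, T x a b := hT2.lintegral_prod_right'
  have hTx : ∀ x, Measurable fun z : ℝ × ℝ => T x z.1 z.2 := by
    intro x
    have h := hmeas.comp (by fun_prop : Measurable fun z : ℝ × ℝ => (x, z.1, z.2))
    exact h
  have hTxa : ∀ x a, Measurable fun b => T x a b := by
    intro x a
    have h := (hTx x).comp (measurable_prodMk_left (x := a))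
    exact h
  have hdiff : ∀ x, ∀ a ∈ I, ∀ b ∈ I, m₀ *
      (‖U (Space.mk x a) - U (Space.mk x b)‖ₑ ^ (2 : ℝ) * powKernel (1 + 2 * s) (a - b)) ≤
      M * (T x a b + T x b a) := fun x a ha b hb => normal_difference_le hs hI hU x ha hb
  have hkey : ∫⁻ x, ∫⁻ a in I, ∫⁻ b in I, T x a b ≤
      B * kernelEnergy (powKernel (d + 1 + 2 * s)) 2 (slab d I) U := key I hIm U hU
  clear_value m₀ M T
  calc m₀ * normalEnergy s I U = ∫⁻ x, ∫⁻ a in I, ∫⁻ b in I, m₀ *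
        (‖U (Space.mk x a) - U (Space.mk x b)‖ₑ ^ (2 : ℝ) * powKernel (1 + 2 * s) (a - b)) := by
        rw [normalEnergy, ← lintegral_const_mul' _ _ hm₀t]
        refine lintegral_congr fun x => ?_
        rw [← lintegral_const_mul' _ _ hm₀t]
        refine lintegral_congr fun a => ?_
        rw [lintegral_const_mul' _ _ hm₀t]
    _ ≤ ∫⁻ x, ∫⁻ a in I, ∫⁻ b in I, M * (T x a b + T x b a) :=
        lintegral_mono fun x => setLIntegral_mono' hIm fun a ha => setLIntegral_mono' hIm fun b hb =>
          hdiff x a ha b hb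
    _ = ∫⁻ x, M * ((∫⁻ a in I, ∫⁻ b in I, T x a b) + ∫⁻ a in I, ∫⁻ b in I, T x a b) := by
        refine lintegral_congr fun x => ?_
        have hsw : ∫⁻ a in I, ∫⁻ b in I, T x b a = ∫⁻ a in I, ∫⁻ b in I, T x a b :=
          lintegral_lintegral_swap ((hTx x).comp measurable_swap).aemeasurable
        trans M * ((∫⁻ a in I, ∫⁻ b in I, T x a b) + ∫⁻ a in I, ∫⁻ b in I, T x b a)
        swap
        · rw [hsw]
        rw [← lintegral_add_left (hTx x).lintegral_prod_right', ← lintegral_const_mul' _ _ hMt.ne]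
        refine lintegral_congr fun a => ?_
        rw [lintegral_const_mul' _ _ hMt.ne, lintegral_add_left (hTxa x a)]
    _ ≤ _ := by
        rw [lintegral_const_mul' _ _ hMt.ne, lintegral_add_left hT1, mul_assoc M, two_mul, add_mul]
        gcongr

end Slicing

/-! ### Integrating out one variable of the kernel -/

section Fubini

variable {d : ℕ}

/-- The kernel `|x - y|^(-e)` in the coordinates `pairCoord`. -/
noncomputable def pairKernel (e : ℝ)
    (w : (EuclideanSpace ℝ (Fin d) × EuclideanSpace ℝ (Fin d)) × ℝ × ℝ) : ℝ :=
  ‖Space.mk w.1.1 w.2.1 - Space.mk w.1.2 w.2.2‖ ^ (-e)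

@[fun_prop] theorem measurable_pairKernel (e : ℝ) : Measurable (pairKernel (d := d) e) := by
  unfold pairKernel; fun_prop

theorem pairKernel_nonneg (e : ℝ)
    (w : (EuclideanSpace ℝ (Fin d) × EuclideanSpace ℝ (Fin d)) × ℝ × ℝ) : 0 ≤ pairKernel e w :=
  Real.rpow_nonneg (norm_nonneg _) _

theorem powKernel_pairCoord (e : ℝ)
    (w : (EuclideanSpace ℝ (Fin d) × EuclideanSpace ℝ (Fin d)) × ℝ × ℝ) :
    powKernel e ((pairCoord d w).1 - (pairCoord d w).2) = ENNReal.ofReal (pairKernel e w) := rfl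

/-- The constant by which integrating out the tangential variables multiplies the kernel. -/
noncomputable def tangentialConst (d : ℕ) (β : ℝ) : ℝ≥0∞ :=
  ∫⁻ z : EuclideanSpace ℝ (Fin d), ENNReal.ofReal ((1 + ‖z‖ ^ 2) ^ (-(d + 1 + β) / 2))

/-- The constant by which integrating out the normal variable multiplies the kernel. -/
noncomputable def normalConst (d : ℕ) (β : ℝ) : ℝ≥0∞ :=
  ∫⁻ z : ℝ, ENNReal.ofReal ((1 + ‖z‖ ^ 2) ^ (-(d + 1 + β) / 2))

theorem tangentialConst_lt_top {β : ℝ} (hβ : 0 < β) : tangentialConst d β < ⊤ :=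
  lintegral_one_add_sq_rpow_lt_top (by simp; linarith)

theorem normalConst_lt_top {β : ℝ} (hβ : 0 < β) : normalConst d β < ⊤ :=
  lintegral_one_add_sq_rpow_lt_top (by
    have : (0 : ℝ) ≤ d := Nat.cast_nonneg _
    simp; linarith)

theorem tangentialConst_ne_zero (β : ℝ) : tangentialConst d β ≠ 0 := by
  refine ((lintegral_pos_iff_support (by fun_prop)).2 ?_).ne'
  have : (Function.support fun z : EuclideanSpace ℝ (Fin d) =>
      ENNReal.ofReal ((1 + ‖z‖ ^ 2) ^ (-(d + 1 + β) / 2))) = univ := by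
    ext z
    simp only [Function.mem_support, ne_eq, ENNReal.ofReal_eq_zero, not_le, mem_univ, iff_true]
    positivity
  rw [this]
  exact isOpen_univ.measure_pos _ univ_nonempty

theorem lintegral_pairKernel_tangential {β : ℝ} (x : EuclideanSpace ℝ (Fin d)) {a b : ℝ}
    (hab : a ≠ b) : ∫⁻ y, ENNReal.ofReal (pairKernel (d + 1 + β) ((x, y), (a, b))) =
      tangentialConst d β * powKernel (1 + β) (a - b) := by
  simp only [pairKernel, Space.norm_mk_sub_rpow, ← sq_abs (a - b)]
  rw [lintegral_sub_left_eq_self (fun y : EuclideanSpace ℝ (Fin d) => ENNReal.ofReal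
    ((‖y‖ ^ 2 + |a - b| ^ 2) ^ (-(d + 1 + β) / 2))) x,
    lintegral_add_sq_rpow _ (abs_pos.2 (sub_ne_zero.2 hab)), mul_comm, tangentialConst, powKernel,
    Real.norm_eq_abs]
  congr 3
  simp only [finrank_euclideanSpace, Fintype.card_fin]
  ring

theorem lintegral_pairKernel_normal {β : ℝ} {x y : EuclideanSpace ℝ (Fin d)} (hxy : x ≠ y) (b : ℝ) :
    ∫⁻ a, ENNReal.ofReal (pairKernel (d + 1 + β) ((x, y), (a, b))) =
      normalConst d β * powKernel (d + β) (x - y) := by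
  simp only [pairKernel, Space.norm_mk_sub_rpow, ← sq_abs (_ - b)]
  simp_rw [add_comm (‖x - y‖ ^ 2)]
  rw [lintegral_sub_right_eq_self (fun a : ℝ => ENNReal.ofReal
    ((|a| ^ 2 + ‖x - y‖ ^ 2) ^ (-(d + 1 + β) / 2))) b]
  simp_rw [← Real.norm_eq_abs]
  rw [lintegral_add_sq_rpow _ (norm_pos_iff.2 (sub_ne_zero.2 hxy)), mul_comm, normalConst, powKernel]
  congr 3
  simp only [Module.finrank_self, Nat.cast_one]
  ring

/-- Integrating out one tangential variable, for an integrand that does not depend on it apart from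
the kernel and that vanishes when the normal variables agree. -/
theorem lintegral_pairMeasure_tangential {β : ℝ} (hβ : 0 < β) (I : Set ℝ)
    {g : EuclideanSpace ℝ (Fin d) × ℝ × ℝ → ℝ≥0∞} (hg : Measurable g)
    (hg0 : ∀ x a, g (x, a, a) = 0) :
    ∫⁻ w, g (w.1.1, w.2) * ENNReal.ofReal (pairKernel (d + 1 + β) w) ∂(pairMeasure d I) =
      tangentialConst d β * ∫⁻ c, (∫⁻ x, g (x, c) * powKernel (1 + β) (c.1 - c.2))
        ∂((volume.restrict I).prod (volume.restrict I)) := by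
  rw [pairMeasure, lintegral_prod_symm _ (Measurable.aemeasurable (by fun_prop)),
    ← lintegral_const_mul' _ _ (tangentialConst_lt_top hβ).ne]
  refine lintegral_congr fun c => ?_
  rw [lintegral_prod _ (Measurable.aemeasurable (by fun_prop)),
    ← lintegral_const_mul' _ _ (tangentialConst_lt_top hβ).ne]
  refine lintegral_congr fun x => ?_
  obtain ⟨a, b⟩ := c
  dsimp only
  rw [lintegral_const_mul _ (by fun_prop)]
  rcases eq_or_ne a b with rfl | hab
  · simp [hg0]
  · rw [lintegral_pairKernel_tangential x hab, mul_left_comm]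

/-- Integrating out one normal variable, for an integrand that does not depend on it apart from
the kernel and that vanishes when the tangential variables agree. -/
theorem lintegral_pairMeasure_normal_le {β : ℝ} (hβ : 0 < β) (I : Set ℝ)
    {g : (EuclideanSpace ℝ (Fin d) × EuclideanSpace ℝ (Fin d)) × ℝ → ℝ≥0∞} (hg : Measurable g)
    (hg0 : ∀ x b, g ((x, x), b) = 0) :
    ∫⁻ w, g (w.1, w.2.2) * ENNReal.ofReal (pairKernel (d + 1 + β) w) ∂(pairMeasure d I) ≤
      normalConst d β * ∫⁻ c, (∫⁻ b in I, g (c, b) * powKernel (d + β) (c.1 - c.2))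
        ∂(volume.prod volume) := by
  rw [pairMeasure, lintegral_prod _ (Measurable.aemeasurable (by fun_prop)),
    ← lintegral_const_mul' _ _ (normalConst_lt_top hβ).ne]
  refine lintegral_mono fun c => ?_
  dsimp only
  rw [lintegral_prod_symm _ (Measurable.aemeasurable (by fun_prop)),
    ← lintegral_const_mul' _ _ (normalConst_lt_top hβ).ne]
  refine lintegral_mono fun b => ?_
  obtain ⟨x, y⟩ := c
  dsimp only
  rw [lintegral_const_mul _ (by fun_prop)]
  rcases eq_or_ne x y with rfl | hxy
  · simp [hg0]
  · rw [mul_left_comm, ← lintegral_pairKernel_normal hxy b]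
    exact mul_le_mul' le_rfl (setLIntegral_le_lintegral _ _)

theorem normalEnergy_eq (s : ℝ) (I : Set ℝ) {U : Space d → ℝ} (hU : Measurable U) :
    normalEnergy s I U = ∫⁻ c, (∫⁻ x, ‖U (Space.mk x c.1) - U (Space.mk x c.2)‖ₑ ^ (2 : ℝ) *
      powKernel (1 + 2 * s) (c.1 - c.2)) ∂((volume.restrict I).prod (volume.restrict I)) := by
  have hk := measurable_powKernel (V := ℝ) (1 + 2 * s)
  rw [lintegral_lintegral_swap (Measurable.aemeasurable (by rw [Function.uncurry_def]; fun_prop)),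
    normalEnergy]
  refine lintegral_congr fun x => ?_
  rw [lintegral_prod _ (Measurable.aemeasurable (by fun_prop))]

end Fubini

/-! ### Tangential averages -/

section Average

variable {d : ℕ}

/-- The average `r ↦ ∫ U(z', r) η(z') dz'` in the tangential variables, on the whole line. -/
noncomputable def sliceAverage (U : Space d → ℝ) (η : EuclideanSpace ℝ (Fin d) → ℝ) (r : ℝ) : ℝ :=
  ∫ z, U (Space.mk z r) * η z

theorem tangentialAverage_eq (U : Space d → ℝ) (η : EuclideanSpace ℝ (Fin d) → ℝ) :
    tangentialAverage U η = (Ioi 0).indicator (sliceAverage U η) := rfl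

theorem measurable_sliceAverage {U : Space d → ℝ} (hU : Measurable U)
    {η : EuclideanSpace ℝ (Fin d) → ℝ} (hη : Measurable η) : Measurable (sliceAverage U η) := by
  have h : StronglyMeasurable fun z : ℝ × EuclideanSpace ℝ (Fin d) =>
      U (Space.mk z.2 z.1) * η z.2 := Measurable.stronglyMeasurable (by fun_prop)
  exact h.integral_prod_right'.measurable

theorem enorm_integral_mul_sq_le {X : Type*} [MeasurableSpace X] {μ : Measure X} {f g : X → ℝ}
    (hf : AEMeasurable f μ) (hg : AEMeasurable g μ) :
    ‖∫ x, f x * g x ∂μ‖ₑ ^ (2 : ℝ) ≤ (∫⁻ x, ‖g x‖ₑ ^ (2 : ℝ) ∂μ) * ∫⁻ x, ‖f x‖ₑ ^ (2 : ℝ) ∂μ := by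
  have h := ENNReal.lintegral_mul_le_Lp_mul_Lq μ Real.HolderConjugate.two_two hf.enorm hg.enorm
  have h2 : ‖∫ x, f x * g x ∂μ‖ₑ ≤ ∫⁻ x, ((fun x => ‖f x‖ₑ) * fun x => ‖g x‖ₑ) x ∂μ :=
    (enorm_integral_le_lintegral_enorm _).trans_eq (by simp [enorm_mul])
  refine (ENNReal.rpow_le_rpow (h2.trans h) (by norm_num)).trans_eq ?_
  rw [ENNReal.mul_rpow_of_nonneg _ _ (by norm_num), ← ENNReal.rpow_mul, ← ENNReal.rpow_mul, mul_comm]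
  norm_num

theorem eLpNorm_two_sq_slab {I : Set ℝ} (hI : MeasurableSet I) {U : Space d → ℝ}
    (hU : Measurable U) :
    eLpNorm U (ENNReal.ofReal 2) (volume.restrict (slab d I)) ^ (2 : ℝ) =
      ∫⁻ a in I, ∫⁻ x, ‖U (Space.mk x a)‖ₑ ^ (2 : ℝ) := by
  rw [eLpNorm_ofReal_rpow (by norm_num), lintegral_slab hI (by fun_prop),
    lintegral_lintegral_swap (Measurable.aemeasurable (by rw [Function.uncurry_def]; fun_prop))]

theorem ae_integrable_slice {I : Set ℝ} (hI : MeasurableSet I) {U : Space d → ℝ}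
    (hU : Measurable U)
    (hfin : eLpNorm U (ENNReal.ofReal 2) (volume.restrict (slab d I)) < ⊤)
    {η : EuclideanSpace ℝ (Fin d) → ℝ} (hη : IsTest univ η) :
    ∀ᵐ a ∂(volume.restrict I), Integrable fun z => U (Space.mk z a) * η z := by
  have h1 : ∫⁻ a in I, ∫⁻ x, ‖U (Space.mk x a)‖ₑ ^ (2 : ℝ) ≠ ⊤ := by
    rw [← eLpNorm_two_sq_slab hI hU]
    exact ENNReal.rpow_ne_top_of_nonneg (by norm_num) hfin.ne
  have hm : Measurable fun a => ∫⁻ x, ‖U (Space.mk x a)‖ₑ ^ (2 : ℝ) :=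
    Measurable.lintegral_prod_right' (f := fun z : ℝ × EuclideanSpace ℝ (Fin d) =>
      ‖U (Space.mk z.2 z.1)‖ₑ ^ (2 : ℝ)) (by fun_prop)
  filter_upwards [ae_lt_top hm h1] with a ha
  have hUa : MemLp (fun z => U (Space.mk z a)) (ENNReal.ofReal 2) volume := by
    refine ⟨(Measurable.aestronglyMeasurable (by fun_prop)), ?_⟩
    rw [eLpNorm_ofReal_eq (by norm_num)]
    exact ENNReal.rpow_lt_top_of_nonneg (by norm_num) ha.ne
  have hη2 : MemLp η (ENNReal.ofReal 2) volume :=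
    hη.smooth.continuous.memLp_of_hasCompactSupport hη.compact
  rw [ENNReal.ofReal_ofNat] at hUa hη2
  exact hUa.integrable_mul hη2

/-- Averaging in the tangential variables maps `W^{s,2}(ℝᵈ × I)` to `W^{s,2}(I)`, by the Cauchy-Schwarz
inequality and the slicing estimate. -/
theorem memSobolev_sliceAverage {s : ℝ} (hs : 0 < s) {I : Set ℝ} (hI : I.OrdConnected)
    (hIm : MeasurableSet I) {U : Space d → ℝ} (hU : Measurable U)
    (hUs : MemSobolev s 2 (slab d I) U) {η : EuclideanSpace ℝ (Fin d) → ℝ} (hη : IsTest univ η) :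
    MemSobolev s 2 I (sliceAverage U η) := by
  have hηm : Measurable η := hη.smooth.continuous.measurable
  have hvm := measurable_sliceAverage hU hηm
  set N := ∫⁻ x, ‖η x‖ₑ ^ (2 : ℝ) with hN
  have hNt : N < ⊤ := by
    rw [hN, ← eLpNorm_ofReal_rpow (by norm_num)]
    exact ENNReal.rpow_lt_top_of_nonneg (by norm_num)
      (hη.smooth.continuous.memLp_of_hasCompactSupport hη.compact).2.ne
  have hU1 : eLpNorm U (ENNReal.ofReal 2) (volume.restrict (slab d I)) < ⊤ :=
    le_self_add.trans_lt hUs.2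
  have hU2 : sobolevSeminorm s 2 (slab d I) U < ⊤ := le_add_self.trans_lt hUs.2
  refine ⟨hvm.aestronglyMeasurable, ENNReal.add_lt_top.2 ⟨?_, ?_⟩⟩
  · rw [eLpNorm_ofReal_eq (by norm_num)]
    refine ENNReal.rpow_lt_top_of_nonneg (by norm_num) (ne_of_lt ?_)
    calc ∫⁻ a in I, ‖sliceAverage U η a‖ₑ ^ (2 : ℝ)
        ≤ ∫⁻ a in I, N * ∫⁻ x, ‖U (Space.mk x a)‖ₑ ^ (2 : ℝ) :=
          lintegral_mono fun a => enorm_integral_mul_sq_le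
            (Measurable.aemeasurable (by fun_prop)) hηm.aemeasurable
      _ = N * eLpNorm U (ENNReal.ofReal 2) (volume.restrict (slab d I)) ^ (2 : ℝ) := by
          rw [lintegral_const_mul' _ _ hNt.ne, eLpNorm_two_sq_slab hIm hU]
      _ < ⊤ := ENNReal.mul_lt_top hNt (ENNReal.rpow_lt_top_of_nonneg (by norm_num) hU1.ne)
  · rw [sobolevSeminorm_eq (by norm_num)]
    refine ENNReal.rpow_lt_top_of_nonneg (by norm_num) (ne_of_lt ?_)
    obtain ⟨C, hC, hnormal⟩ := normalEnergy_le (d := d) hs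
    have hae := ae_integrable_slice hIm hU hU1 hη
    rw [Module.finrank_self, Nat.cast_one, kernelEnergy, mul_comm s]
    calc _ ≤ ∫⁻ c, (N * ∫⁻ x, ‖U (Space.mk x c.1) - U (Space.mk x c.2)‖ₑ ^ (2 : ℝ) *
          powKernel (1 + 2 * s) (c.1 - c.2)) ∂((volume.restrict I).prod (volume.restrict I)) := by
          refine lintegral_mono_ae ?_
          filter_upwards [Measure.quasiMeasurePreserving_fst.ae hae,
            Measure.quasiMeasurePreserving_snd.ae hae] with c h1 h2
          have : sliceAverage U η c.1 - sliceAverage U η c.2 =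
              ∫ x, (U (Space.mk x c.1) - U (Space.mk x c.2)) * η x := by
            rw [sliceAverage, sliceAverage, ← integral_sub h1 h2]
            simp only [sub_mul]
          rw [this, lintegral_mul_const _ (by fun_prop), ← mul_assoc]
          exact mul_le_mul' (enorm_integral_mul_sq_le
            (Measurable.aemeasurable (by fun_prop)) hηm.aemeasurable) le_rfl
      _ = N * normalEnergy s I U := by
          rw [lintegral_const_mul' _ _ hNt.ne, normalEnergy_eq s I hU]
      _ < ⊤ := by
          refine ENNReal.mul_lt_top hNt ((hnormal I hI hIm U hU).trans_lt (ENNReal.mul_lt_top hC ?_))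
          have := sobolevSeminorm_rpow (τ := s) (q := 2) (by norm_num) (slab d I) U
          rw [Space.finrank_eq, mul_comm s] at this
          rw [← this]
          exact ENNReal.rpow_lt_top_of_nonneg (by norm_num) hU2.ne

end Average

/-! ### The form tested with tensor products -/

section Forms

theorem restrict_prod_le {X : Type*} [MeasureSpace X] [SFinite (volume : Measure X)] (Ω : Set X) :
    (volume.restrict Ω).prod (volume.restrict Ω) ≤
      ((volume : Measure X).restrict univ).prod (volume.restrict univ) := by
  rw [Measure.prod_restrict, Measure.prod_restrict]
  exact Measure.restrict_mono (prod_mono (subset_univ _) (subset_univ _)) le_rfl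

theorem integrable_mul_mul_of_energy {X : Type*} [MeasurableSpace X] {μ : Measure X} {f g k : X → ℝ}
    (hf : Measurable f) (hg : Measurable g) (hk : Measurable k) (hk0 : ∀ x, 0 ≤ k x)
    (hfk : ∫⁻ x, ‖f x‖ₑ ^ (2 : ℝ) * ENNReal.ofReal (k x) ∂μ < ⊤)
    (hgk : ∫⁻ x, ‖g x‖ₑ ^ (2 : ℝ) * ENNReal.ofReal (k x) ∂μ < ⊤) :
    Integrable (fun x => f x * g x * k x) μ := by
  refine ⟨Measurable.aestronglyMeasurable (by fun_prop), ?_⟩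
  refine lt_of_le_of_lt (lintegral_mono fun x => ?_) ((lintegral_add_left (by fun_prop) _).trans_lt
    (ENNReal.add_lt_top.2 ⟨hfk, hgk⟩))
  rw [enorm_mul, enorm_mul, Real.enorm_of_nonneg (hk0 x), ← add_mul]
  refine mul_le_mul' ?_ le_rfl
  rw [ENNReal.rpow_two, ENNReal.rpow_two, pow_two, pow_two]
  rcases le_total ‖f x‖ₑ ‖g x‖ₑ with h | h
  · exact le_add_left (mul_le_mul' h le_rfl)
  · exact le_add_right (mul_le_mul' le_rfl h)

section General

variable {V : Type*} [NormedAddCommGroup V] [NormedSpace ℝ V]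

theorem diffQuot_mul_diffQuot (s : ℝ) (u φ : V → ℝ) (z : V × V) :
    diffQuot s 2 u z * diffQuot s 2 φ z = (u z.1 - u z.2) * (φ z.1 - φ z.2) /
      ‖z.1 - z.2‖ ^ ((Module.finrank ℝ V : ℝ) + 2 * s) := by
  rw [diffQuot, diffQuot, div_mul_div_comm, ← pow_two (_ ^ _), ← Real.rpow_natCast,
    ← Real.rpow_mul (norm_nonneg _)]
  congr 2
  push_cast; ring

variable [MeasureSpace V] [BorelSpace V] [SecondCountableTopology V] [SFinite (volume : Measure V)]

theorem integrable_regionalForm {s : ℝ} {Ω : Set V} {u φ : V → ℝ} (hu : MemSobolev s 2 Ω u)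
    (hφ : MemSobolev s 2 Ω φ) :
    Integrable (fun z : V × V => (u z.1 - u z.2) * (φ z.1 - φ z.2) /
      ‖z.1 - z.2‖ ^ ((Module.finrank ℝ V : ℝ) + 2 * s))
      ((volume.restrict Ω).prod (volume.restrict Ω)) := by
  simp_rw [← diffQuot_mul_diffQuot]
  have h1 := hu.memLp_diffQuot
  have h2 := hφ.memLp_diffQuot
  rw [ENNReal.ofReal_ofNat] at h1 h2
  exact h1.integrable_mul h2

omit [BorelSpace V] [SecondCountableTopology V] in
theorem sobolevNorm_le_univ (s q : ℝ) (Ω : Set V) (f : V → ℝ) :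
    sobolevNorm s q Ω f ≤ sobolevNorm s q univ f :=
  add_le_add (eLpNorm_mono_measure _ (Measure.restrict_mono (subset_univ _) le_rfl))
    (eLpNorm_mono_measure _ (restrict_prod_le Ω))

omit [BorelSpace V] [SecondCountableTopology V] in
theorem MemSobolev.of_univ {s q : ℝ} {f : V → ℝ} (hf : MemSobolev s q univ f) (Ω : Set V) :
    MemSobolev s q Ω f :=
  ⟨hf.1.mono_measure (Measure.restrict_mono (subset_univ _) le_rfl),
    (sobolevNorm_le_univ s q Ω f).trans_lt hf.2⟩

end General

variable {d : ℕ}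

/-- The function `(x', xₙ) ↦ η(x') ψ(xₙ)`. -/
def tensor (η : EuclideanSpace ℝ (Fin d) → ℝ) (ψ : ℝ → ℝ) (P : Space d) : ℝ := η P.fst * ψ P.snd

theorem IsTest.tensor {η : EuclideanSpace ℝ (Fin d) → ℝ} {ψ : ℝ → ℝ} (hη : IsTest univ η)
    (hψ : IsTest (Ioi 0) ψ) : IsTest (upperHalf d) (tensor η ψ) := by
  set K : Set (Space d) :=
    (fun w : EuclideanSpace ℝ (Fin d) × ℝ => Space.mk w.1 w.2) '' (tsupport η ×ˢ tsupport ψ)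
  have hKc : IsCompact K := (hη.compact.isCompact.prod hψ.compact.isCompact).image
    Space.continuous_mk
  have hsupp : Function.support (_root_.tensor η ψ) ⊆ K := by
    intro P hP
    refine ⟨(P.fst, P.snd), ⟨subset_tsupport _ ?_, subset_tsupport _ ?_⟩, rfl⟩
    · exact left_ne_zero_of_mul hP
    · exact right_ne_zero_of_mul hP
  have hts : tsupport (_root_.tensor η ψ) ⊆ K := closure_minimal hsupp hKc.isClosed
  refine ⟨?_, hKc.of_isClosed_subset (isClosed_tsupport _) hts, hts.trans ?_⟩
  · have hL := (WithLp.prodContinuousLinearEquiv 2 ℝ (EuclideanSpace ℝ (Fin d)) ℝ).contDiff (n := ∞)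
    exact (hη.smooth.comp hL.fst).mul (hψ.smooth.comp hL.snd)
  · rintro _ ⟨w, hw, rfl⟩
    exact hψ.support hw.2

/-- The integrand of the remainder, in which only tangential differences of `U` occur. -/
noncomputable def remainderIntegrand (s : ℝ) (U : Space d → ℝ) (η : EuclideanSpace ℝ (Fin d) → ℝ)
    (ψ : ℝ → ℝ) (w : (EuclideanSpace ℝ (Fin d) × EuclideanSpace ℝ (Fin d)) × ℝ × ℝ) : ℝ :=
  (η w.1.1 - η w.1.2) * (U (Space.mk w.1.1 w.2.1) - U (Space.mk w.1.2 w.2.1)) * ψ w.2.2 *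
    pairKernel (d + 1 + 2 * s) w

/-- The integrand of the principal part, in which only normal differences of `U` occur. -/
noncomputable def principalIntegrand (s : ℝ) (U : Space d → ℝ) (η : EuclideanSpace ℝ (Fin d) → ℝ)
    (ψ : ℝ → ℝ) (w : (EuclideanSpace ℝ (Fin d) × EuclideanSpace ℝ (Fin d)) × ℝ × ℝ) : ℝ :=
  (U (Space.mk w.1.1 w.2.1) - U (Space.mk w.1.1 w.2.2)) * (η w.1.1 * (ψ w.2.1 - ψ w.2.2)) *
    pairKernel (d + 1 + 2 * s) w

/-- The differences in the normal direction have finite energy by the slicing estimate. -/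
theorem integrable_principalIntegrand {s : ℝ} (hs : 0 < s) (hs1 : s < 1) {U : Space d → ℝ}
    (hU : Measurable U) (hUs : MemSobolev s 2 (upperHalf d) U)
    {η : EuclideanSpace ℝ (Fin d) → ℝ} (hη : IsTest univ η) {ψ : ℝ → ℝ} (hψ : IsTest (Ioi 0) ψ) :
    Integrable (principalIntegrand s U η ψ) (pairMeasure d (Ioi 0)) := by
  have hηm : Measurable η := hη.smooth.continuous.measurable
  have hψm : Measurable ψ := hψ.smooth.continuous.measurable
  have hs2 : 0 < 2 * s := by positivity
  refine integrable_mul_mul_of_energy (by fun_prop) (by fun_prop) (by fun_prop)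
    (pairKernel_nonneg _) ?_ ?_
  · rw [lintegral_pairMeasure_tangential hs2 (Ioi 0)
      (g := fun w => ‖U (Space.mk w.1 w.2.1) - U (Space.mk w.1 w.2.2)‖ₑ ^ (2 : ℝ))
      (by fun_prop) (by simp), ← normalEnergy_eq s _ hU]
    obtain ⟨C, hC, hnormal⟩ := normalEnergy_le (d := d) hs
    refine ENNReal.mul_lt_top (tangentialConst_lt_top hs2)
      ((hnormal _ ordConnected_Ioi measurableSet_Ioi U hU).trans_lt (ENNReal.mul_lt_top hC ?_))
    have := sobolevSeminorm_rpow (τ := s) (q := 2) (by norm_num) (upperHalf d) U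
    rw [Space.finrank_eq, mul_comm s] at this
    rw [slab_Ioi, ← this]
    exact ENNReal.rpow_lt_top_of_nonneg (by norm_num) (le_add_self.trans_lt hUs.2).ne
  · rw [lintegral_pairMeasure_tangential hs2 (Ioi 0)
      (g := fun w => ‖η w.1 * (ψ w.2.1 - ψ w.2.2)‖ₑ ^ (2 : ℝ)) (by fun_prop) (by simp)]
    refine ENNReal.mul_lt_top (tangentialConst_lt_top hs2) ?_
    have hη2 : ∫⁻ x, ‖η x‖ₑ ^ (2 : ℝ) < ⊤ := by
      rw [← eLpNorm_ofReal_rpow (by norm_num)]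
      exact ENNReal.rpow_lt_top_of_nonneg (by norm_num)
        (hη.smooth.continuous.memLp_of_hasCompactSupport hη.compact).2.ne
    have hψ2 : kernelEnergy (powKernel (1 + 2 * s)) 2 (Ioi 0) ψ < ⊤ := by
      have := sobolevSeminorm_rpow (τ := s) (q := 2) (by norm_num) (Ioi 0) ψ
      rw [Module.finrank_self, Nat.cast_one, mul_comm s] at this
      rw [← this]
      exact ENNReal.rpow_lt_top_of_nonneg (by norm_num) (le_add_self.trans_lt
        ((hψ.memSobolev hs hs1 (by norm_num)).of_univ _).2).ne
    calc _ = (∫⁻ x, ‖η x‖ₑ ^ (2 : ℝ)) * kernelEnergy (powKernel (1 + 2 * s)) 2 (Ioi 0) ψ := by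
          rw [kernelEnergy, ← lintegral_const_mul' _ _ hη2.ne]
          refine lintegral_congr fun c => ?_
          rw [← lintegral_mul_const _ (by fun_prop)]
          refine lintegral_congr fun x => ?_
          rw [enorm_mul, ENNReal.mul_rpow_of_nonneg _ _ (by norm_num), mul_assoc]
      _ < ⊤ := ENNReal.mul_lt_top hη2 hψ2

/-- Integrating out the tangential variable `y'` leaves the kernel of the one-dimensional form. -/
theorem integral_pairKernel_tangential {β : ℝ} (x : EuclideanSpace ℝ (Fin d)) {a b : ℝ}
    (hab : a ≠ b) : ∫ y, pairKernel (d + 1 + β) ((x, y), (a, b)) =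
      (tangentialConst d β).toReal * ‖a - b‖ ^ (-(1 + β)) := by
  rw [integral_eq_lintegral_of_nonneg_ae (Filter.Eventually.of_forall fun y => pairKernel_nonneg _ _)
    (Measurable.aestronglyMeasurable (by fun_prop)), lintegral_pairKernel_tangential x hab,
    ENNReal.toReal_mul, powKernel, ENNReal.toReal_ofReal (by positivity)]

/-- The principal part is a multiple of the one-dimensional form of the tangential average. -/
theorem integral_principalIntegrand {s : ℝ} (hs : 0 < s) (hs1 : s < 1) {U : Space d → ℝ}
    (hU : Measurable U) (hUs : MemSobolev s 2 (upperHalf d) U)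
    {η : EuclideanSpace ℝ (Fin d) → ℝ} (hη : IsTest univ η) {ψ : ℝ → ℝ} (hψ : IsTest (Ioi 0) ψ) :
    ∫ w, principalIntegrand s U η ψ w ∂(pairMeasure d (Ioi 0)) =
      (tangentialConst d (2 * s)).toReal * regionalForm s (Ioi 0) (sliceAverage U η) ψ := by
  have hint := integrable_principalIntegrand hs hs1 hU hUs hη hψ
  have hU1 : eLpNorm U (ENNReal.ofReal 2) (volume.restrict (slab d (Ioi 0))) < ⊤ :=
    le_self_add.trans_lt hUs.2
  have hae := ae_integrable_slice measurableSet_Ioi hU hU1 hη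
  rw [pairMeasure] at hint ⊢
  rw [integral_prod_symm _ hint, regionalForm, ← integral_const_mul]
  refine integral_congr_ae ?_
  filter_upwards [hint.prod_left_ae, Measure.quasiMeasurePreserving_fst.ae hae,
    Measure.quasiMeasurePreserving_snd.ae hae] with c hc h1 h2
  obtain ⟨a, b⟩ := c
  dsimp only at hc h1 h2 ⊢
  rcases eq_or_ne a b with rfl | hab
  · simp [principalIntegrand]
  rw [integral_prod _ hc]
  have hdiff : sliceAverage U η a - sliceAverage U η b =
      ∫ x, (U (Space.mk x a) - U (Space.mk x b)) * η x := by
    rw [sliceAverage, sliceAverage, ← integral_sub h1 h2]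
    simp only [sub_mul]
  simp only [principalIntegrand]
  simp_rw [integral_const_mul, integral_pairKernel_tangential _ hab]
  rw [integral_mul_const, hdiff, Module.finrank_self, Nat.cast_one, Real.rpow_neg (norm_nonneg _)]
  simp_rw [← mul_assoc]
  rw [integral_mul_const]
  ring

/-- Exchanging the tangential variables of the two points, and exchanging their normal variables,
are two measure preserving involutions. After symmetrization with respect to both, all terms of the
form with a test function `η ⊗ ψ` that contain mixed differences of `U` cancel. -/
theorem regionalForm_tensor {s : ℝ} (hs : 0 < s) (hs1 : s < 1) {U : Space d → ℝ}
    (hU : Measurable U) (hUs : MemSobolev s 2 (upperHalf d) U)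
    {η : EuclideanSpace ℝ (Fin d) → ℝ} (hη : IsTest univ η) {ψ : ℝ → ℝ} (hψ : IsTest (Ioi 0) ψ)
    (hR : Integrable (remainderIntegrand s U η ψ) (pairMeasure d (Ioi 0))) :
    regionalForm s (upperHalf d) U (tensor η ψ) =
      (tangentialConst d (2 * s)).toReal * regionalForm s (Ioi 0) (sliceAverage U η) ψ +
        ∫ w, remainderIntegrand s U η ψ w ∂(pairMeasure d (Ioi 0)) := by
  have hA := integrable_principalIntegrand hs hs1 hU hUs hη hψ
  have hT : MemSobolev s 2 (upperHalf d) (tensor η ψ) :=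
    ((hη.tensor hψ).memSobolev hs hs1 (by norm_num)).of_univ _
  have hF0 := integrable_regionalForm hUs hT
  rw [← slab_Ioi] at hF0
  have hF1 := ((measurePreserving_pairCoord (d := d) measurableSet_Ioi).integrable_comp_emb
    (pairCoord d).measurableEmbedding).2 hF0
  set F : (EuclideanSpace ℝ (Fin d) × EuclideanSpace ℝ (Fin d)) × ℝ × ℝ → ℝ := fun w =>
    (U (Space.mk w.1.1 w.2.1) - U (Space.mk w.1.2 w.2.2)) *
      (η w.1.1 * ψ w.2.1 - η w.1.2 * ψ w.2.2) * pairKernel (d + 1 + 2 * s) w with hFdef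
  have hFeq : ∀ w, (U (pairCoord d w).1 - U (pairCoord d w).2) *
      (tensor η ψ (pairCoord d w).1 - tensor η ψ (pairCoord d w).2) /
      ‖(pairCoord d w).1 - (pairCoord d w).2‖ ^ ((Module.finrank ℝ (Space d) : ℝ) + 2 * s) = F w := by
    intro w
    rw [hFdef, pairCoord_apply, Space.finrank_eq, div_eq_mul_inv, ← Real.rpow_neg (norm_nonneg _)]
    rfl
  have hF : Integrable F (pairMeasure d (Ioi 0)) := by
    refine hF1.congr (Filter.Eventually.of_forall fun w => ?_)
    exact hFeq w
  have hform : regionalForm s (upperHalf d) U (tensor η ψ) =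
      ∫ w, F w ∂(pairMeasure d (Ioi 0)) := by
    rw [regionalForm, ← slab_Ioi, integral_pairCoord measurableSet_Ioi]
    simp_rw [hFeq]
  set A := principalIntegrand s U η ψ with hAdef
  set R := remainderIntegrand s U η ψ with hRdef
  set S₁ : (EuclideanSpace ℝ (Fin d) × EuclideanSpace ℝ (Fin d)) × ℝ × ℝ ≃ᵐ
    (EuclideanSpace ℝ (Fin d) × EuclideanSpace ℝ (Fin d)) × ℝ × ℝ :=
    MeasurableEquiv.prodComm.prodCongr (MeasurableEquiv.refl _)
  set S₂ : (EuclideanSpace ℝ (Fin d) × EuclideanSpace ℝ (Fin d)) × ℝ × ℝ ≃ᵐ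
    (EuclideanSpace ℝ (Fin d) × EuclideanSpace ℝ (Fin d)) × ℝ × ℝ :=
    (MeasurableEquiv.refl _).prodCongr MeasurableEquiv.prodComm
  have hS1p : MeasurePreserving S₁ (pairMeasure d (Ioi 0)) (pairMeasure d (Ioi 0)) :=
    Measure.measurePreserving_swap.prod (MeasurePreserving.id _)
  have hS2p : MeasurePreserving S₂ (pairMeasure d (Ioi 0)) (pairMeasure d (Ioi 0)) :=
    (MeasurePreserving.id _).prod Measure.measurePreserving_swap
  have hS1a : ∀ w, S₁ w = ((w.1.2, w.1.1), w.2) := fun w => rfl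
  have hS2a : ∀ w, S₂ w = (w.1, (w.2.2, w.2.1)) := fun w => rfl
  have hpt : ∀ w, F w + F (S₁ w) = (A w + A (S₁ w)) + (R w + R (S₂ w)) := by
    intro w
    have k1 : ∀ e : ℝ, pairKernel e ((w.1.2, w.1.1), w.2) = pairKernel e w := by
      intro e
      rw [pairKernel, pairKernel, Space.norm_mk_sub_rpow, Space.norm_mk_sub_rpow, norm_sub_rev]
    have k2 : ∀ e : ℝ, pairKernel e (w.1, (w.2.2, w.2.1)) = pairKernel e w := by
      intro e
      rw [pairKernel, pairKernel, Space.norm_mk_sub_rpow, Space.norm_mk_sub_rpow]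
      congr 1; ring
    simp only [hS1a, hS2a, hFdef, hAdef, hRdef, principalIntegrand, remainderIntegrand, k1, k2]
    ring
  have cF := hS1p.integral_comp S₁.measurableEmbedding F
  have cA := hS1p.integral_comp S₁.measurableEmbedding A
  have cR := hS2p.integral_comp S₂.measurableEmbedding R
  have iF : Integrable (fun w => F (S₁ w)) (pairMeasure d (Ioi 0)) :=
    (hS1p.integrable_comp_emb S₁.measurableEmbedding).2 hF
  have iA : Integrable (fun w => A (S₁ w)) (pairMeasure d (Ioi 0)) :=
    (hS1p.integrable_comp_emb S₁.measurableEmbedding).2 hA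
  have iR : Integrable (fun w => R (S₂ w)) (pairMeasure d (Ioi 0)) :=
    (hS2p.integrable_comp_emb S₂.measurableEmbedding).2 hR
  have hsum := integral_congr_ae (μ := pairMeasure d (Ioi 0)) (Filter.Eventually.of_forall hpt)
  have hAA : Integrable (fun w => A w + A (S₁ w)) (pairMeasure d (Ioi 0)) := hA.add iA
  have hRR : Integrable (fun w => R w + R (S₂ w)) (pairMeasure d (Ioi 0)) := hR.add iR
  rw [integral_add hF iF, integral_add hAA hRR, integral_add hA iA,
    integral_add hR iR, cF, cA, cR] at hsum
  rw [hform, ← integral_principalIntegrand hs hs1 hU hUs hη hψ]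
  linarith

theorem tangentialSeminorm_eq {s' p : ℝ} (hp : 0 < p) (U : Space d → ℝ) :
    tangentialSeminorm s' p U =
      (∫⁻ w, ‖U (Space.mk w.1.1 w.2.1) - U (Space.mk w.1.2 w.2.1)‖ₑ ^ p *
        ENNReal.ofReal (pairKernel (((d + 1) / p + s') * p) w) ∂(pairMeasure d (Ioi 0))) ^ (1 / p) := by
  rw [tangentialSeminorm, eLpNorm_ofReal_eq hp, ← slab_Ioi, lintegral_pairCoord measurableSet_Ioi]
  congr 1
  refine lintegral_congr fun w => ?_
  rw [enorm_div_rpow hp _ _ _ (norm_nonneg _)]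
  rfl

/-- Hölder's inequality for the remainder: the tangential seminorm of `U` against
`|η(x') - η(y')| |ψ(yₙ)|`, in which the normal variable `xₙ` can be integrated out. -/
theorem lintegral_remainderIntegrand_le {s s' p q : ℝ} (hpq : p.HolderConjugate q) (hs : 0 < s)
    (hσ : 0 < 2 * s - s') {U : Space d → ℝ} (hU : Measurable U)
    {η : EuclideanSpace ℝ (Fin d) → ℝ} (hη : Measurable η) {ψ : ℝ → ℝ} (hψ : Measurable ψ) :
    ∫⁻ w, ‖remainderIntegrand s U η ψ w‖ₑ ∂(pairMeasure d (Ioi 0)) ≤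
      normalConst d ((2 * s - s') * q) ^ (1 / q) * tangentialSeminorm s' p U *
        sobolevSeminorm (2 * s - s') q univ η *
        eLpNorm ψ (ENNReal.ofReal q) (volume.restrict (Ioi 0)) := by
  have hp0 := hpq.pos
  have hq0 := hpq.symm.pos
  have hqi : 0 ≤ 1 / q := by positivity
  set σ := 2 * s - s' with hσdef
  have hsplit : ((d : ℝ) + 1) / p + s' + (((d : ℝ) + 1) / q + σ) = d + 1 + 2 * s := by
    have h1 : p⁻¹ + q⁻¹ = 1 := hpq.inv_add_inv_eq_one
    rw [div_eq_mul_inv, div_eq_mul_inv, hσdef]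
    linear_combination ((d : ℝ) + 1) * h1
  have hmain := ENNReal.lintegral_mul_le_Lp_mul_Lq (pairMeasure d (Ioi 0)) hpq
    (f := fun w => ‖U (Space.mk w.1.1 w.2.1) - U (Space.mk w.1.2 w.2.1)‖ₑ *
      ENNReal.ofReal (pairKernel (((d : ℝ) + 1) / p + s') w))
    (g := fun w => ‖η w.1.1 - η w.1.2‖ₑ * ‖ψ w.2.2‖ₑ *
      ENNReal.ofReal (pairKernel (((d : ℝ) + 1) / q + σ) w))
    (Measurable.aemeasurable (by fun_prop)) (Measurable.aemeasurable (by fun_prop))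
  have hpow : ∀ (e r : ℝ), 0 < r → ∀ w : (EuclideanSpace ℝ (Fin d) × EuclideanSpace ℝ (Fin d)) × ℝ × ℝ,
      ENNReal.ofReal (pairKernel e w) ^ r = ENNReal.ofReal (pairKernel (e * r) w) := by
    intro e r hr w
    rw [ENNReal.ofReal_rpow_of_nonneg (pairKernel_nonneg _ _) hr.le, pairKernel, pairKernel,
      ← Real.rpow_mul (norm_nonneg _), neg_mul]
  have h1 : (∫⁻ w, (‖U (Space.mk w.1.1 w.2.1) - U (Space.mk w.1.2 w.2.1)‖ₑ *
      ENNReal.ofReal (pairKernel (((d : ℝ) + 1) / p + s') w)) ^ p ∂(pairMeasure d (Ioi 0))) ^ (1 / p) =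
      tangentialSeminorm s' p U := by
    rw [tangentialSeminorm_eq hp0]
    simp_rw [ENNReal.mul_rpow_of_nonneg _ _ hp0.le, hpow _ _ hp0]
  have h2 : (∫⁻ w, (‖η w.1.1 - η w.1.2‖ₑ * ‖ψ w.2.2‖ₑ *
      ENNReal.ofReal (pairKernel (((d : ℝ) + 1) / q + σ) w)) ^ q ∂(pairMeasure d (Ioi 0))) ^ (1 / q) ≤
      normalConst d (σ * q) ^ (1 / q) * sobolevSeminorm σ q univ η *
        eLpNorm ψ (ENNReal.ofReal q) (volume.restrict (Ioi 0)) := by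
    rw [sobolevSeminorm_eq hq0, eLpNorm_ofReal_eq hq0, ← ENNReal.mul_rpow_of_nonneg _ _ hqi,
      ← ENNReal.mul_rpow_of_nonneg _ _ hqi]
    refine ENNReal.rpow_le_rpow ?_ hqi
    simp_rw [ENNReal.mul_rpow_of_nonneg _ _ hq0.le, hpow _ _ hq0]
    have he : (((d : ℝ) + 1) / q + σ) * q = d + 1 + σ * q := by field_simp
    rw [he]
    refine (lintegral_pairMeasure_normal_le (β := σ * q) (by positivity) (Ioi 0)
      (g := fun z => ‖η z.1.1 - η z.1.2‖ₑ ^ q * ‖ψ z.2‖ₑ ^ q) (by fun_prop)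
      (by simp [hq0])).trans_eq ?_
    rw [mul_assoc, kernelEnergy, Measure.restrict_univ]
    congr 1
    have hk := measurable_powKernel (V := EuclideanSpace ℝ (Fin d)) (d + σ * q)
    rw [finrank_euclideanSpace, Fintype.card_fin, ← lintegral_mul_const _ (by fun_prop)]
    refine lintegral_congr fun c => ?_
    rw [← lintegral_const_mul _ (by fun_prop)]
    refine lintegral_congr fun b => ?_
    ring
  calc _ ≤ _ := lintegral_mono fun w => ?_
    _ ≤ _ := hmain
    _ ≤ tangentialSeminorm s' p U * (normalConst d (σ * q) ^ (1 / q) * sobolevSeminorm σ q univ η *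
        eLpNorm ψ (ENNReal.ofReal q) (volume.restrict (Ioi 0))) := by
      rw [h1]; exact mul_le_mul' le_rfl h2
    _ = _ := by ring
  simp only [Pi.mul_apply]
  rw [remainderIntegrand, enorm_mul, enorm_mul, enorm_mul, Real.enorm_of_nonneg (pairKernel_nonneg _ _)]
  have hk : ENNReal.ofReal (pairKernel (d + 1 + 2 * s) w) ≤
      ENNReal.ofReal (pairKernel (((d : ℝ) + 1) / p + s') w) *
        ENNReal.ofReal (pairKernel (((d : ℝ) + 1) / q + σ) w) := by
    rw [← ENNReal.ofReal_mul (pairKernel_nonneg _ _), ← hsplit]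
    refine ENNReal.ofReal_le_ofReal ?_
    rw [pairKernel, pairKernel, pairKernel, neg_add]
    refine (Real.rpow_add' (norm_nonneg _) ?_).le
    rw [← neg_add, hsplit]
    have : (0 : ℝ) < d + 1 + 2 * s := by positivity
    exact neg_ne_zero.2 this.ne'
  calc _ ≤ ‖η w.1.1 - η w.1.2‖ₑ * ‖U (Space.mk w.1.1 w.2.1) - U (Space.mk w.1.2 w.2.1)‖ₑ *
        ‖ψ w.2.2‖ₑ * (ENNReal.ofReal (pairKernel (((d : ℝ) + 1) / p + s') w) *
        ENNReal.ofReal (pairKernel (((d : ℝ) + 1) / q + σ) w)) := by gcongr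
    _ = _ := by ring

/-- The Gagliardo seminorm of a tensor product. -/
theorem sobolevSeminorm_tensor_le {τ q : ℝ} (hτ : 0 < τ) (hq : 1 ≤ q) :
    ∃ C : ℝ≥0∞, C < ⊤ ∧ ∀ (η : EuclideanSpace ℝ (Fin d) → ℝ) (ψ : ℝ → ℝ), Measurable η →
      Measurable ψ → sobolevSeminorm τ q univ (tensor η ψ) ≤
        C * (eLpNorm η (ENNReal.ofReal q) volume * sobolevSeminorm τ q univ ψ +
          sobolevSeminorm τ q univ η * eLpNorm ψ (ENNReal.ofReal q) volume) := by
  have hq0 : 0 < q := by linarith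
  have hqi : 0 ≤ 1 / q := by positivity
  have hτq : 0 < τ * q := by positivity
  set T := tangentialConst d (τ * q)
  set N := normalConst d (τ * q)
  have hTt : T < ⊤ := tangentialConst_lt_top hτq
  have hNt : N < ⊤ := normalConst_lt_top hτq
  set M : ℝ≥0∞ := 2 ^ (q - 1)
  have hMt : M < ⊤ := ENNReal.rpow_lt_top_of_nonneg (by linarith) (by simp)
  refine ⟨(M * (T + N)) ^ (1 / q), ENNReal.rpow_lt_top_of_nonneg hqi (ENNReal.mul_lt_top hMt
    (ENNReal.add_lt_top.2 ⟨hTt, hNt⟩)).ne, fun η ψ hη hψ => ?_⟩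
  set X := (∫⁻ x, ‖η x‖ₑ ^ q) * kernelEnergy (powKernel (1 + τ * q)) q univ ψ with hX
  set Y := kernelEnergy (powKernel (d + τ * q)) q univ η * ∫⁻ b, ‖ψ b‖ₑ ^ q with hY
  have e1 : ∫⁻ w, ‖η w.1.1 * (ψ w.2.1 - ψ w.2.2)‖ₑ ^ q *
      ENNReal.ofReal (pairKernel (d + 1 + τ * q) w) ∂(pairMeasure d univ) = T * X := by
    rw [lintegral_pairMeasure_tangential hτq univ
      (g := fun w => ‖η w.1 * (ψ w.2.1 - ψ w.2.2)‖ₑ ^ q) (by fun_prop) (by simp [hq0]), hX, kernelEnergy]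
    congr 1
    have hk := measurable_powKernel (V := ℝ) (1 + τ * q)
    rw [← lintegral_const_mul _ (by fun_prop)]
    refine lintegral_congr fun c => ?_
    rw [← lintegral_mul_const _ (by fun_prop)]
    refine lintegral_congr fun x => ?_
    rw [enorm_mul, ENNReal.mul_rpow_of_nonneg _ _ hq0.le, mul_assoc]
  have e2 : ∫⁻ w, (‖η w.1.1 - η w.1.2‖ₑ ^ q * ‖ψ w.2.2‖ₑ ^ q) *
      ENNReal.ofReal (pairKernel (d + 1 + τ * q) w) ∂(pairMeasure d univ) ≤ N * Y := by
    refine (lintegral_pairMeasure_normal_le hτq univ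
      (g := fun z => ‖η z.1.1 - η z.1.2‖ₑ ^ q * ‖ψ z.2‖ₑ ^ q) (by fun_prop)
      (by simp [hq0])).trans_eq ?_
    rw [hY, kernelEnergy, Measure.restrict_univ, Measure.restrict_univ]
    congr 1
    have hk := measurable_powKernel (V := EuclideanSpace ℝ (Fin d)) (d + τ * q)
    rw [← lintegral_mul_const _ (by fun_prop)]
    refine lintegral_congr fun c => ?_
    rw [← lintegral_const_mul _ (by fun_prop)]
    refine lintegral_congr fun b => ?_
    ring
  have e3 : kernelEnergy (powKernel (d + 1 + τ * q)) q univ (tensor η ψ) ≤ M * (T + N) * (X + Y) := by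
    rw [kernelEnergy, ← slab_univ, lintegral_pairCoord MeasurableSet.univ]
    calc _ ≤ ∫⁻ w, (M * (‖η w.1.1 * (ψ w.2.1 - ψ w.2.2)‖ₑ ^ q *
            ENNReal.ofReal (pairKernel (d + 1 + τ * q) w)) +
          M * ((‖η w.1.1 - η w.1.2‖ₑ ^ q * ‖ψ w.2.2‖ₑ ^ q) *
            ENNReal.ofReal (pairKernel (d + 1 + τ * q) w))) ∂(pairMeasure d univ) := by
          refine lintegral_mono fun w => ?_
          rw [powKernel_pairCoord, ← mul_add, ← add_mul, ← mul_assoc, pairCoord_apply]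
          refine mul_le_mul' ?_ le_rfl
          have h : tensor η ψ (Space.mk w.1.1 w.2.1) - tensor η ψ (Space.mk w.1.2 w.2.2) =
              η w.1.1 * (ψ w.2.1 - ψ w.2.2) + (η w.1.1 - η w.1.2) * ψ w.2.2 := by
            simp only [tensor, Space.fst_mk, Space.snd_mk]; ring
          dsimp only
          rw [h, ← ENNReal.mul_rpow_of_nonneg ‖η w.1.1 - η w.1.2‖ₑ _ hq0.le, ← enorm_mul]
          exact (ENNReal.rpow_le_rpow (enorm_add_le _ _) hq0.le).trans
            (ENNReal.rpow_add_le_mul_rpow_add_rpow _ _ hq)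
      _ ≤ M * (T * X) + M * (N * Y) := by
          rw [lintegral_add_left (by fun_prop), lintegral_const_mul _ (by fun_prop),
            lintegral_const_mul _ (by fun_prop), e1]
          gcongr
      _ ≤ M * ((T + N) * X) + M * ((T + N) * Y) := by
          gcongr
          · exact le_self_add
          · exact le_add_self
      _ = _ := by ring
  have hXq : X ^ (1 / q) = eLpNorm η (ENNReal.ofReal q) volume * sobolevSeminorm τ q univ ψ := by
    rw [hX, ENNReal.mul_rpow_of_nonneg _ _ hqi, eLpNorm_ofReal_eq hq0, sobolevSeminorm_eq hq0,
      Module.finrank_self, Nat.cast_one]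
  have hYq : Y ^ (1 / q) = sobolevSeminorm τ q univ η * eLpNorm ψ (ENNReal.ofReal q) volume := by
    rw [hY, ENNReal.mul_rpow_of_nonneg _ _ hqi, eLpNorm_ofReal_eq hq0, sobolevSeminorm_eq hq0,
      finrank_euclideanSpace, Fintype.card_fin]
  rw [sobolevSeminorm_eq hq0 univ (tensor η ψ), Space.finrank_eq, ← hXq, ← hYq]
  refine (ENNReal.rpow_le_rpow e3 hqi).trans ?_
  rw [ENNReal.mul_rpow_of_nonneg _ _ hqi]
  exact mul_le_mul' le_rfl (ENNReal.rpow_add_le_add_rpow _ _ hqi (by rwa [div_le_one hq0]))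

theorem eLpNorm_tensor {q : ℝ} (hq : 0 < q) {η : EuclideanSpace ℝ (Fin d) → ℝ} {ψ : ℝ → ℝ}
    (hη : Measurable η) (hψ : Measurable ψ) :
    eLpNorm (tensor η ψ) (ENNReal.ofReal q) volume =
      eLpNorm η (ENNReal.ofReal q) volume * eLpNorm ψ (ENNReal.ofReal q) volume := by
  rw [eLpNorm_ofReal_eq hq, eLpNorm_ofReal_eq hq, eLpNorm_ofReal_eq hq,
    ← ENNReal.mul_rpow_of_nonneg _ _ (by positivity)]
  congr 1
  have hm : Measurable (tensor η ψ) := by unfold tensor; fun_prop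
  have h := lintegral_slab (d := d) MeasurableSet.univ (F := fun P => ‖tensor η ψ P‖ₑ ^ q) (by fun_prop)
  rw [slab_univ, Measure.restrict_univ, Measure.restrict_univ] at h
  rw [h, ← lintegral_mul_const _ (by fun_prop)]
  refine lintegral_congr fun x => ?_
  rw [← lintegral_const_mul _ (by fun_prop)]
  refine lintegral_congr fun a => ?_
  rw [tensor, enorm_mul, ENNReal.mul_rpow_of_nonneg _ _ hq.le, Space.fst_mk, Space.snd_mk]

end Forms

/-! ### Invariance under passage to a representative -/

section Congruence

section General

variable {V : Type*} [NormedAddCommGroup V] [NormedSpace ℝ V] [MeasureSpace V]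
  {Ω : Set V} {u u' : V → ℝ}

theorem diffQuot_congr_ae (h : u =ᵐ[volume.restrict Ω] u') (s q : ℝ) :
    diffQuot s q u =ᵐ[(volume.restrict Ω).prod (volume.restrict Ω)] diffQuot s q u' := by
  filter_upwards [Measure.quasiMeasurePreserving_fst.ae h,
    Measure.quasiMeasurePreserving_snd.ae h] with z h1 h2
  rw [diffQuot, diffQuot, h1, h2]

theorem MemSobolev.congr {s q : ℝ} (hu : MemSobolev s q Ω u) (h : u =ᵐ[volume.restrict Ω] u') :
    MemSobolev s q Ω u' := by
  refine ⟨hu.1.congr h, ?_⟩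
  rw [sobolevNorm, sobolevSeminorm, ← eLpNorm_congr_ae h, ← eLpNorm_congr_ae (diffQuot_congr_ae h s q)]
  exact hu.2

theorem regionalForm_congr_ae (h : u =ᵐ[volume.restrict Ω] u') (s : ℝ) (φ : V → ℝ) :
    regionalForm s Ω u φ = regionalForm s Ω u' φ := by
  refine integral_congr_ae ?_
  filter_upwards [Measure.quasiMeasurePreserving_fst.ae h,
    Measure.quasiMeasurePreserving_snd.ae h] with z h1 h2
  rw [h1, h2]

end General

variable {d : ℕ} {u u' : Space d → ℝ}

theorem tangentialSeminorm_congr_ae {s' p : ℝ} (hp : 0 < p)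
    (h : u =ᵐ[volume.restrict (upperHalf d)] u') :
    tangentialSeminorm s' p u = tangentialSeminorm s' p u' := by
  rw [tangentialSeminorm_eq hp, tangentialSeminorm_eq hp]
  congr 1
  refine lintegral_congr_ae ?_
  rw [← slab_Ioi] at h
  have h0 := (measurePreserving_mk (d := d) (Ioi 0) measurableSet_Ioi).quasiMeasurePreserving.ae h
  have q1 : Measure.QuasiMeasurePreserving
      (Prod.map Prod.fst Prod.fst : (EuclideanSpace ℝ (Fin d) × EuclideanSpace ℝ (Fin d)) × ℝ × ℝ → _)
      (pairMeasure d (Ioi 0)) (volume.prod (volume.restrict (Ioi 0))) :=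
    MeasureTheory.QuasiMeasurePreserving.prodMap Measure.quasiMeasurePreserving_fst
      Measure.quasiMeasurePreserving_fst
  have q2 : Measure.QuasiMeasurePreserving
      (Prod.map Prod.snd Prod.fst : (EuclideanSpace ℝ (Fin d) × EuclideanSpace ℝ (Fin d)) × ℝ × ℝ → _)
      (pairMeasure d (Ioi 0)) (volume.prod (volume.restrict (Ioi 0))) :=
    MeasureTheory.QuasiMeasurePreserving.prodMap Measure.quasiMeasurePreserving_snd
      Measure.quasiMeasurePreserving_fst
  filter_upwards [q1.ae h0, q2.ae h0] with w h1 h2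
  simp only [Prod.map_fst, Prod.map_snd] at h1 h2
  rw [h1, h2]

theorem sliceAverage_congr_ae {I : Set ℝ} (hI : MeasurableSet I)
    (h : u =ᵐ[volume.restrict (slab d I)] u') (η : EuclideanSpace ℝ (Fin d) → ℝ) :
    sliceAverage u η =ᵐ[volume.restrict I] sliceAverage u' η := by
  have h0 := (measurePreserving_mk (d := d) I hI).quasiMeasurePreserving.ae h
  have h1 := Measure.ae_ae_of_ae_prod (Measure.measurePreserving_swap
    (μ := volume.restrict I) (ν := (volume : Measure (EuclideanSpace ℝ (Fin d))))
    |>.quasiMeasurePreserving.ae h0)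
  filter_upwards [h1] with a ha
  refine integral_congr_ae ?_
  filter_upwards [ha] with x hx
  simp only [Prod.swap_prod_mk] at hx
  rw [hx]

end Congruence

/-! ### Extension of the form from test functions -/

section Extension

section General

variable {V : Type*} [NormedAddCommGroup V] [NormedSpace ℝ V]

theorem IsTest.zero (Ω : Set V) : IsTest Ω (0 : V → ℝ) :=
  ⟨contDiff_const, HasCompactSupport.zero, by simp [tsupport]⟩

theorem IsTest.add {Ω : Set V} {f g : V → ℝ} (hf : IsTest Ω f) (hg : IsTest Ω g) :
    IsTest Ω (f + g) :=
  ⟨hf.smooth.add hg.smooth, hf.compact.add hg.compact,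
    (tsupport_add f g).trans (union_subset hf.support hg.support)⟩

theorem IsTest.smul {Ω : Set V} {f : V → ℝ} (hf : IsTest Ω f) (c : ℝ) : IsTest Ω (c • f) :=
  ⟨contDiff_const.smul hf.smooth, hf.compact.smul_left,
    (closure_mono (Function.support_const_smul_subset c f)).trans hf.support⟩

variable [MeasureSpace V]

theorem sobolevNorm_add_le [BorelSpace V] [SecondCountableTopology V]
    [SFinite (volume : Measure V)] {s q : ℝ} (hq : 1 ≤ q) {Ω : Set V} {f g : V → ℝ}
    (hf : MemSobolev s q Ω f) (hg : MemSobolev s q Ω g) :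
    sobolevNorm s q Ω (f + g) ≤ sobolevNorm s q Ω f + sobolevNorm s q Ω g := by
  have h : diffQuot s q (f + g) = diffQuot s q f + diffQuot s q g := by
    funext z
    simp only [diffQuot, Pi.add_apply]
    ring
  have hq' : 1 ≤ ENNReal.ofReal q := by simpa using hq
  rw [sobolevNorm, sobolevNorm, sobolevNorm, sobolevSeminorm, h, add_add_add_comm]
  exact add_le_add (eLpNorm_add_le hf.1 hg.1 hq')
    (eLpNorm_add_le hf.memLp_diffQuot.1 hg.memLp_diffQuot.1 hq')

theorem sobolevNorm_smul (s q : ℝ) (Ω : Set V) (c : ℝ) (f : V → ℝ) :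
    sobolevNorm s q Ω (c • f) = ‖c‖ₑ * sobolevNorm s q Ω f := by
  have h : diffQuot s q (c • f) = c • diffQuot s q f := by
    funext z
    simp only [diffQuot, Pi.smul_apply, smul_eq_mul]
    ring
  rw [sobolevNorm, sobolevNorm, sobolevSeminorm, h, eLpNorm_const_smul, eLpNorm_const_smul, mul_add,
    sobolevSeminorm]

end General

theorem IsTest.mem_sobolevZero {Ω : Set ℝ} {ψ : ℝ → ℝ} (hψ : IsTest Ω ψ) {σ q : ℝ} (hσ : 0 < σ)
    (hσ1 : σ < 1) (hq : 1 ≤ q) : ψ ∈ sobolevZero σ q Ω :=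
  ⟨hψ.memSobolev hσ hσ1 hq, Filter.Eventually.of_forall fun _ hx => hψ.eq_zero_of_notMem hx⟩

/-- The test functions on `Ω`, as a subspace of `W₀^{σ,q}(Ω)`. -/
def testSubmodule (σ q : ℝ) (Ω : Set ℝ) : Submodule ℝ (sobolevZero σ q Ω) where
  carrier := {ψ | IsTest Ω (ψ : ℝ → ℝ)}
  zero_mem' := IsTest.zero Ω
  add_mem' hf hg := IsTest.add hf hg
  smul_mem' c _ hf := IsTest.smul hf c

theorem regionalForm_add {s : ℝ} {Ω : Set ℝ} {v f g : ℝ → ℝ} (hv : MemSobolev s 2 Ω v)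
    (hf : MemSobolev s 2 Ω f) (hg : MemSobolev s 2 Ω g) :
    regionalForm s Ω v (f + g) = regionalForm s Ω v f + regionalForm s Ω v g := by
  rw [regionalForm, regionalForm, regionalForm,
    ← integral_add (integrable_regionalForm hv hf) (integrable_regionalForm hv hg)]
  refine integral_congr_ae (Filter.Eventually.of_forall fun z => ?_)
  simp only [Pi.add_apply]
  ring

theorem regionalForm_smul (s : ℝ) (Ω : Set ℝ) (v f : ℝ → ℝ) (c : ℝ) :
    regionalForm s Ω v (c • f) = c * regionalForm s Ω v f := by
  rw [regionalForm, regionalForm, ← integral_const_mul]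
  refine integral_congr_ae (Filter.Eventually.of_forall fun z => ?_)
  simp only [Pi.smul_apply, smul_eq_mul]
  ring

/-- A bound for the form on test functions by the norm of `W^{σ,q}(Ω)` extends the form, by the
Hahn-Banach theorem, to a linear functional on `W₀^{σ,q}(Ω)` with the same bound. -/
theorem exists_extension_regionalForm {s σ q : ℝ} (hs : 0 < s) (hs1 : s < 1) (hσ : 0 < σ)
    (hσ1 : σ < 1) (hq : 1 ≤ q) {Ω : Set ℝ} {v : ℝ → ℝ} (hv : MemSobolev s 2 Ω v) {K : ℝ≥0∞}
    (hK : K < ⊤)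
    (hbound : ∀ ψ, IsTest Ω ψ → ‖regionalForm s Ω v ψ‖ₑ ≤ K * sobolevNorm σ q Ω ψ) :
    ∃ H : sobolevZero σ q Ω →ₗ[ℝ] ℝ,
      (∀ ψ : ℝ → ℝ, IsTest Ω ψ → ∃ hψ : ψ ∈ sobolevZero σ q Ω,
        regionalForm s Ω v ψ = H ⟨ψ, hψ⟩) ∧
      ∀ ψ : sobolevZero σ q Ω, ENNReal.ofReal |H ψ| ≤ K * sobolevNorm σ q Ω (ψ : ℝ → ℝ) := by
  have hmem : ∀ ψ : sobolevZero σ q Ω, MemSobolev σ q Ω (ψ : ℝ → ℝ) := fun ψ => ψ.2.1.of_univ Ω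
  have hmem2 : ∀ ψ : ℝ → ℝ, IsTest Ω ψ → MemSobolev s 2 Ω ψ := fun ψ hψ =>
    (hψ.memSobolev hs hs1 (by norm_num)).of_univ Ω
  let f : sobolevZero σ q Ω →ₗ.[ℝ] ℝ :=
    { domain := testSubmodule σ q Ω
      toFun :=
        { toFun := fun ψ => regionalForm s Ω v (ψ : sobolevZero σ q Ω)
          map_add' := fun ψ₁ ψ₂ => regionalForm_add hv (hmem2 _ ψ₁.2) (hmem2 _ ψ₂.2)
          map_smul' := fun c ψ => regionalForm_smul s Ω v _ c } }
  have hfin : ∀ ψ : sobolevZero σ q Ω, K * sobolevNorm σ q Ω (ψ : ℝ → ℝ) ≠ ⊤ := fun ψ =>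
    ENNReal.mul_ne_top hK.ne (hmem ψ).2.ne
  have hhom : ∀ c : ℝ, 0 < c → ∀ ψ : sobolevZero σ q Ω,
      (K * sobolevNorm σ q Ω ((c • ψ : sobolevZero σ q Ω) : ℝ → ℝ)).toReal =
        c * (K * sobolevNorm σ q Ω (ψ : ℝ → ℝ)).toReal := by
    intro c hc ψ
    have h1 : ((c • ψ : sobolevZero σ q Ω) : ℝ → ℝ) = c • (ψ : ℝ → ℝ) := rfl
    rw [h1, sobolevNorm_smul, mul_left_comm, ENNReal.toReal_mul, Real.enorm_of_nonneg hc.le,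
      ENNReal.toReal_ofReal hc.le]
  have hsub : ∀ ψ₁ ψ₂ : sobolevZero σ q Ω,
      (K * sobolevNorm σ q Ω ((ψ₁ + ψ₂ : sobolevZero σ q Ω) : ℝ → ℝ)).toReal ≤
        (K * sobolevNorm σ q Ω (ψ₁ : ℝ → ℝ)).toReal +
          (K * sobolevNorm σ q Ω (ψ₂ : ℝ → ℝ)).toReal := by
    intro ψ₁ ψ₂
    rw [← ENNReal.toReal_add (hfin ψ₁) (hfin ψ₂), ← mul_add]
    refine ENNReal.toReal_mono (ENNReal.mul_ne_top hK.ne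
      (ENNReal.add_ne_top.2 ⟨(hmem ψ₁).2.ne, (hmem ψ₂).2.ne⟩)) ?_
    exact mul_le_mul' le_rfl (sobolevNorm_add_le hq (hmem ψ₁) (hmem ψ₂))
  have hdom : ∀ ψ : f.domain, f ψ ≤ (K * sobolevNorm σ q Ω ((ψ : sobolevZero σ q Ω) : ℝ → ℝ)).toReal := by
    intro ψ
    have h := hbound _ ψ.2
    rw [← ofReal_norm, ENNReal.ofReal_le_iff_le_toReal (hfin ψ.1)] at h
    exact (le_abs_self _).trans h
  obtain ⟨H, hH, hHN⟩ := exists_extension_of_le_sublinear f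
    (fun ψ => (K * sobolevNorm σ q Ω (ψ : ℝ → ℝ)).toReal) hhom hsub hdom
  refine ⟨H, fun ψ hψ => ⟨hψ.mem_sobolevZero hσ hσ1 hq, ?_⟩, fun ψ => ?_⟩
  · exact (hH ⟨⟨ψ, hψ.mem_sobolevZero hσ hσ1 hq⟩, hψ⟩).symm
  · rw [ENNReal.ofReal_le_iff_le_toReal (hfin ψ)]
    refine abs_le.2 ⟨?_, hHN ψ⟩
    have h := hHN (-ψ)
    have h1 : sobolevNorm σ q Ω ((-ψ : sobolevZero σ q Ω) : ℝ → ℝ) =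
        sobolevNorm σ q Ω (ψ : ℝ → ℝ) := by
      have := sobolevNorm_smul σ q Ω (-1) (ψ : ℝ → ℝ)
      simpa using this
    rw [map_neg, h1] at h
    linarith

end Extension

/-! ### The estimate on test functions, and the functional -/

section Estimate

variable {d : ℕ}

/-- The order `τ` only has to exceed `t`; it is chosen away from the critical exponent of Hardy's
inequality. -/
theorem exists_noncritical_order {t σ q : ℝ} (ht : 0 ≤ t) (htσ : t < σ) (hq : 0 < q) :
    ∃ τ, 0 < τ ∧ t < τ ∧ τ ≤ σ ∧ τ * q ≠ 1 := by
  by_cases h : (t + σ) / 2 * q = 1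
  · refine ⟨(t + 3 * σ) / 4, by linarith, by linarith, by linarith, fun h' => ?_⟩
    have := mul_right_cancel₀ hq.ne' (h.trans h'.symm)
    linarith
  · exact ⟨(t + σ) / 2, by linarith, by linarith, by linarith, h⟩

theorem IsTest.eLpNorm_restrict {V : Type*} [NormedAddCommGroup V] [NormedSpace ℝ V]
    [MeasureSpace V] {Ω : Set V} {ψ : V → ℝ} (hψ : IsTest Ω ψ) (r : ℝ≥0∞) :
    eLpNorm ψ r (volume.restrict Ω) = eLpNorm ψ r volume :=
  eLpNorm_restrict_eq_of_support_subset ((subset_tsupport _).trans hψ.support)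

/-- The norm of `η ⊗ ψ` on the whole space, of a noncritical order `τ ≤ σ`, in terms of the norms of
order `σ` of the factors, where that of `ψ` is taken on the half-line only. -/
theorem sobolevNorm_tensor_le {τ σ q : ℝ} (hτ : 0 < τ) (hτσ : τ ≤ σ) (hq : 1 ≤ q)
    (hτq : τ * q ≠ 1) :
    ∃ C : ℝ≥0∞, C < ⊤ ∧ ∀ (η : EuclideanSpace ℝ (Fin d) → ℝ) (ψ : ℝ → ℝ), IsTest univ η →
      IsTest (Ioi 0) ψ → sobolevNorm τ q univ (tensor η ψ) ≤
        C * sobolevNorm σ q univ η * sobolevNorm σ q (Ioi 0) ψ := by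
  obtain ⟨C₂, hC₂, h₂⟩ := sobolevSeminorm_tensor_le (d := d) hτ hq
  obtain ⟨C₃, hC₃, h₃⟩ := sobolevSeminorm_le_of_le (V := EuclideanSpace ℝ (Fin d)) hτ hτσ hq
  obtain ⟨C₄, hC₄, h₄⟩ := sobolevSeminorm_le_of_le (V := ℝ) hτ hτσ hq
  obtain ⟨C₅, hC₅, h₅⟩ := sobolevSeminorm_univ_le_Ioi hτ hq hτq
  refine ⟨1 + C₂ * (C₅ * C₄ + C₃), ENNReal.add_lt_top.2 ⟨ENNReal.one_lt_top, ENNReal.mul_lt_top hC₂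
    (ENNReal.add_lt_top.2 ⟨ENNReal.mul_lt_top hC₅ hC₄, hC₃⟩)⟩, fun η ψ hη hψ => ?_⟩
  have hηm : Measurable η := hη.smooth.continuous.measurable
  have hψm : Measurable ψ := hψ.smooth.continuous.measurable
  set X := sobolevNorm σ q univ η with hX
  set Y := sobolevNorm σ q (Ioi 0) ψ with hY
  have a1 : eLpNorm η (ENNReal.ofReal q) volume ≤ X := by
    rw [hX, sobolevNorm, Measure.restrict_univ]; exact le_self_add
  have a2 : eLpNorm ψ (ENNReal.ofReal q) volume ≤ Y := by
    rw [hY, sobolevNorm, hψ.eLpNorm_restrict]; exact le_self_add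
  have a3 : sobolevSeminorm τ q univ η ≤ C₃ * X := h₃ univ η hηm.aemeasurable
  have a4 : sobolevSeminorm τ q univ ψ ≤ C₅ * (C₄ * Y) :=
    (h₅ ψ hψ).trans (mul_le_mul' le_rfl (h₄ (Ioi 0) ψ hψm.aemeasurable))
  calc sobolevNorm τ q univ (tensor η ψ)
      ≤ eLpNorm η (ENNReal.ofReal q) volume * eLpNorm ψ (ENNReal.ofReal q) volume +
        C₂ * (eLpNorm η (ENNReal.ofReal q) volume * sobolevSeminorm τ q univ ψ +
          sobolevSeminorm τ q univ η * eLpNorm ψ (ENNReal.ofReal q) volume) := by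
        rw [sobolevNorm, Measure.restrict_univ, eLpNorm_tensor (by linarith) hηm hψm]
        exact add_le_add le_rfl (h₂ η ψ hηm hψm)
    _ ≤ X * Y + C₂ * (X * (C₅ * (C₄ * Y)) + C₃ * X * Y) := by gcongr
    _ = _ := by ring

/-- The estimate of the one-dimensional form of the tangential average on test functions. -/
theorem enorm_regionalForm_sliceAverage_le {s s' t p q : ℝ} (hs : 0 < s) (hs1 : s < 1)
    (ht : 0 ≤ t) (htσ : t < 2 * s - s') (hpq : p.HolderConjugate q) :
    ∃ C : ℝ≥0∞, C < ⊤ ∧ ∀ (G U : Space d → ℝ) (η : EuclideanSpace ℝ (Fin d) → ℝ) (ψ : ℝ → ℝ),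
      AEMeasurable G volume → Measurable U → MemSobolev s 2 (upperHalf d) U →
      tangentialSeminorm s' p U < ⊤ → SolvesHalfSpace s t G U → IsTest univ η →
      IsTest (Ioi 0) ψ →
      sobolevNorm (2 * s - s') q univ η < ⊤ → sobolevNorm (2 * s - s') q (Ioi 0) ψ < ⊤ →
      ‖regionalForm s (Ioi 0) (sliceAverage U η) ψ‖ₑ ≤
        C * (eLpNorm G (ENNReal.ofReal p) volume + tangentialSeminorm s' p U) *
          sobolevNorm (2 * s - s') q univ η * sobolevNorm (2 * s - s') q (Ioi 0) ψ := by
  have hq0 := hpq.symm.pos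
  have hq1 := hpq.symm.lt.le
  set σ := 2 * s - s'
  have hσ : 0 < σ := ht.trans_lt htσ
  obtain ⟨τ, hτ, htτ, hτσ, hτq⟩ := exists_noncritical_order ht htσ hq0
  have : Nontrivial (Space d) := by
    have : 0 < Module.finrank ℝ (Space d) := by
      have := Space.finrank_eq (d := d)
      exact_mod_cast this.symm ▸ (by positivity : (0 : ℝ) < d + 1)
    exact Module.nontrivial_of_finrank_pos this
  obtain ⟨C₁, hC₁, h₁⟩ := enorm_integral_mul_fracDeriv_le (V := Space d) hpq ht htτ
  obtain ⟨C₂, hC₂, h₂⟩ := sobolevNorm_tensor_le (d := d) hτ hτσ hq1 hτq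
  set c := (tangentialConst d (2 * s)).toReal
  have hc0 : c ≠ 0 := (ENNReal.toReal_pos (tangentialConst_ne_zero _)
    (tangentialConst_lt_top (by positivity)).ne).ne'
  set N := normalConst d (σ * q) ^ (1 / q)
  have hNt : N < ⊤ := ENNReal.rpow_lt_top_of_nonneg (by positivity)
    (normalConst_lt_top (by positivity)).ne
  refine ⟨‖c⁻¹‖ₑ * (C₁ * C₂ + N), ENNReal.mul_lt_top enorm_lt_top (ENNReal.add_lt_top.2
    ⟨ENNReal.mul_lt_top hC₁ hC₂, hNt⟩), fun G U η ψ hG hU hUs hUT hsol hη hψ hηN hψN => ?_⟩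
  have hηm : Measurable η := hη.smooth.continuous.measurable
  have hψm : Measurable ψ := hψ.smooth.continuous.measurable
  set X := sobolevNorm σ q univ η
  set Y := sobolevNorm σ q (Ioi 0) ψ
  set g := eLpNorm G (ENNReal.ofReal p) volume
  set T := tangentialSeminorm s' p U
  have hrem : ∫⁻ w, ‖remainderIntegrand s U η ψ w‖ₑ ∂(pairMeasure d (Ioi 0)) ≤ N * T * X * Y := by
    refine (lintegral_remainderIntegrand_le hpq hs hσ hU hηm hψm).trans ?_
    gcongr
    · exact le_add_self
    · exact le_self_add
  have hR : Integrable (remainderIntegrand s U η ψ) (pairMeasure d (Ioi 0)) := by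
    refine ⟨Measurable.aestronglyMeasurable (by unfold remainderIntegrand; fun_prop), ?_⟩
    exact hrem.trans_lt (ENNReal.mul_lt_top (ENNReal.mul_lt_top (ENNReal.mul_lt_top hNt hUT) hηN) hψN)
  have hid := regionalForm_tensor hs hs1 hU hUs hη hψ hR
  rw [hsol _ (hη.tensor hψ)] at hid
  have hform : regionalForm s (Ioi 0) (sliceAverage U η) ψ =
      c⁻¹ * ((∫ x, G x * fracDeriv t (tensor η ψ) x) -
        ∫ w, remainderIntegrand s U η ψ w ∂(pairMeasure d (Ioi 0))) := by
    rw [hid]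
    field_simp
    ring
  have hφm : Measurable (tensor η ψ) := by unfold tensor; fun_prop
  calc ‖regionalForm s (Ioi 0) (sliceAverage U η) ψ‖ₑ
      ≤ ‖c⁻¹‖ₑ * (‖∫ x, G x * fracDeriv t (tensor η ψ) x‖ₑ +
        ‖∫ w, remainderIntegrand s U η ψ w ∂(pairMeasure d (Ioi 0))‖ₑ) := by
        rw [hform, enorm_mul]
        exact mul_le_mul' le_rfl enorm_sub_le
    _ ≤ ‖c⁻¹‖ₑ * (C₁ * g * (C₂ * X * Y) + N * T * X * Y) := by
        gcongr
        · exact (h₁ G _ hG hφm).trans (mul_le_mul' le_rfl (h₂ η ψ hη hψ))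
        · exact (enorm_integral_le_lintegral_enorm _).trans hrem
    _ = ‖c⁻¹‖ₑ * (C₁ * C₂) * g * X * Y + ‖c⁻¹‖ₑ * N * T * X * Y := by ring
    _ ≤ ‖c⁻¹‖ₑ * (C₁ * C₂ + N) * g * X * Y + ‖c⁻¹‖ₑ * (C₁ * C₂ + N) * T * X * Y := by
        gcongr
        · exact le_self_add
        · exact le_add_self
    _ = _ := by ring

end Estimate

theorem theorem1p2 (d : ℕ) (hd : 1 ≤ d) (s s' t p p' : ℝ)
    (hs : s ∈ Ioo (1 / 2 : ℝ) 1) (hs' : s' ∈ Ioo s 1) (ht : 0 ≤ t)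
    (hmax : max t (1 / 2) < 2 * s - s') (hp : 2 < p) (hpp' : 1 / p + 1 / p' = 1) :
    ∃ C : NNReal, ∀ (G u : Space d → ℝ) (η : EuclideanSpace ℝ (Fin d) → ℝ),
      MemLp G (ENNReal.ofReal p) volume →
      MemSobolev s 2 (upperHalf d) u →
      tangentialSeminorm s' p u < ⊤ →
      SolvesHalfSpace s t G u →
      IsTest univ η →
      MemSobolev s 2 (Ioi (0 : ℝ)) (tangentialAverage u η) ∧
      ((upperHalf d).indicator u ∈ sobolevZero s 2 (upperHalf d) →
        tangentialAverage u η ∈ sobolevZero s 2 (Ioi (0 : ℝ))) ∧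
      ∃ H : sobolevZero (2 * s - s') p' (Ioi (0 : ℝ)) →ₗ[ℝ] ℝ,
        (∀ ψ : ℝ → ℝ, IsTest (Ioi (0 : ℝ)) ψ →
          ∃ hψ : ψ ∈ sobolevZero (2 * s - s') p' (Ioi (0 : ℝ)),
            regionalForm s (Ioi (0 : ℝ)) (tangentialAverage u η) ψ = H ⟨ψ, hψ⟩) ∧
        ∀ ψ : sobolevZero (2 * s - s') p' (Ioi (0 : ℝ)),
          ENNReal.ofReal |H ψ| ≤
            C * (eLpNorm G (ENNReal.ofReal p) volume + tangentialSeminorm s' p u) *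
              sobolevNorm (2 * s - s') p' univ η *
              sobolevNorm (2 * s - s') p' (Ioi (0 : ℝ)) (ψ : ℝ → ℝ) := by
  have hs0 : 0 < s := by linarith [hs.1]
  have hpq : p.HolderConjugate p' := Real.holderConjugate_iff.2 ⟨by linarith, by simpa using hpp'⟩
  have hq1 : 1 ≤ p' := hpq.symm.lt.le
  have htσ : t < 2 * s - s' := (le_max_left _ _).trans_lt hmax
  have hσ0 : 0 < 2 * s - s' := ht.trans_lt htσ
  have hσ1 : 2 * s - s' < 1 := by linarith [hs.2, hs'.1]
  have hE : Nontrivial (EuclideanSpace ℝ (Fin d)) :=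
    Module.nontrivial_of_finrank_pos (R := ℝ) (by rw [finrank_euclideanSpace, Fintype.card_fin]; exact hd)
  obtain ⟨C, hC, hmain⟩ := enorm_regionalForm_sliceAverage_le (d := d) hs0 hs.2 ht htσ hpq
  refine ⟨C.toNNReal, fun G u η hG hu huT hsol hη => ?_⟩
  rw [ENNReal.coe_toNNReal hC.ne]
  -- pass to a representative that is measurable on the whole space
  set U := hu.1.mk u
  have hU : Measurable U := hu.1.stronglyMeasurable_mk.measurable
  have hae : u =ᵐ[volume.restrict (upperHalf d)] U := hu.1.ae_eq_mk
  have hUs : MemSobolev s 2 (upperHalf d) U := hu.congr hae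
  have hT : tangentialSeminorm s' p u = tangentialSeminorm s' p U :=
    tangentialSeminorm_congr_ae hpq.pos hae
  have hUsol : SolvesHalfSpace s t G U := fun φ hφ => by
    rw [← regionalForm_congr_ae hae]; exact hsol φ hφ
  have hav : sliceAverage U η =ᵐ[volume.restrict (Ioi 0)] tangentialAverage u η := by
    have h1 := sliceAverage_congr_ae (I := Ioi 0) measurableSet_Ioi hae η
    filter_upwards [h1, ae_restrict_mem measurableSet_Ioi] with r hr hr0
    rw [tangentialAverage_eq, indicator_of_mem hr0, hr]
  have hv : MemSobolev s 2 (Ioi 0) (tangentialAverage u η) :=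
    (memSobolev_sliceAverage hs0 ordConnected_Ioi measurableSet_Ioi hU hUs hη).congr hav
  refine ⟨hv, fun hzero => ⟨?_, Filter.Eventually.of_forall fun r hr => indicator_of_notMem hr _⟩, ?_⟩
  · -- the zero extension of the average is the average of the zero extension, on the whole line
    have hw : MemSobolev s 2 (slab d univ) ((upperHalf d).indicator u) := by
      rw [slab_univ]; exact hzero.1
    have hae' := hw.1.ae_eq_mk
    refine ((memSobolev_sliceAverage hs0 ordConnected_univ MeasurableSet.univ
      hw.1.stronglyMeasurable_mk.measurable (hw.congr hae') hη).congr
        (sliceAverage_congr_ae MeasurableSet.univ hae'.symm η)).congr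
          (Filter.Eventually.of_forall fun r => ?_)
    rw [tangentialAverage_eq]
    by_cases hr : r ∈ Ioi (0 : ℝ)
    · rw [indicator_of_mem hr]
      refine integral_congr_ae (Filter.Eventually.of_forall fun z => ?_)
      have : Space.mk z r ∈ upperHalf d := hr
      simp only [indicator_of_mem this]
    · rw [indicator_of_notMem hr]
      have : ∀ z : EuclideanSpace ℝ (Fin d), Space.mk z r ∉ upperHalf d := fun z => hr
      simp [sliceAverage, indicator_of_notMem (this _)]
  · have hηN : sobolevNorm (2 * s - s') p' univ η < ⊤ := (hη.memSobolev hσ0 hσ1 hq1).2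
    refine exists_extension_regionalForm hs0 hs.2 hσ0 hσ1 hq1 hv (ENNReal.mul_lt_top
      (ENNReal.mul_lt_top hC (ENNReal.add_lt_top.2 ⟨hG.2, huT⟩)) hηN) fun ψ hψ => ?_
    rw [← regionalForm_congr_ae hav, hT]
    exact hmain G U η ψ hG.1.aemeasurable hU hUs (hT ▸ huT) hUsol hη hψ hηN
      ((hψ.memSobolev hσ0 hσ1 hq1).of_univ _).2
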